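/- Let $X=(X_t)_{t\ge 0}$ be a subordinator, i.e. a real-valued process with $X_0=0$, stationary and independent increments and almost surely right-continuous non-decreasing paths, with drift $\delta>0$ and Lévy measure $\Pi$ on $(0,\infty)$, $\int_0^\infty (1\wedge x)\,\Pi(dx)<\infty$; that is, $\mathbb E[e^{-\lambda X_t}]=\exp\big(-t\big(\delta\lambda+\int_0^\infty(1-e^{-\lambda x})\,\Pi(dx)\big)\big)$ for $\lambda,t\ge 0$. Put $\bar\Pi(x)=\Pi([x,\infty))$ for $x>0$, let $q\ge 0$, and let $U^{(q)}(dx)=\mathbb E\big[\int_0^\infty e^{-qt}\mathbf 1_{\{X_t\in dx\}}\,dt\big]$ be the $q$-potential measure. Write $\bar\Pi+q$ for the function equal to $\bar\Pi(x)+q$ for $x>0$ and to $0$ for $x\le 0$, $f*g(x)=\int_0^x f(x-y)g(y)\,dy$ for the convolution (with powers $f^{*1}=f$, $f^{*(n+1)}=f^{*n}*f$), $\mathcal Lf(s)=\int_{-\infty}^\infty e^{-sx}f(x)\,dx$ for the bilateral Laplace transform, and $\beta(\Pi)=\inf\{\gamma>0:\int_0^1 x^\gamma\,\Pi(dx)<\infty\}$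 for the Blumenthal–Getoor index. The measure $U^{(q)}$ has a density $u^{(q)}$ with respect to Lebesgue measure on $(0,\infty)$ which is continuous there (and hence unique). For every $x>0$ the right and left derivatives of $u^{(q)}$ at $x$ exist and are given by the convergent series $$\big(u^{(q)}\big)'(x\pm)=-\frac{\bar\Pi(x\pm)+q}{\delta^2}+\sum_{n=2}^\infty\frac{(-1)^n}{\delta^{n+1}}\big(\bar\Pi+q\big)^{*n}(x),$$ where $\bar\Pi(x\pm)$ are the one-sided limits of $\bar\Pi$ at $x$. Moreover, if $\beta(\Pi)<1$, then for every integer $N>\frac{1}{1-\beta(\Pi)}$ and every $\lambda>0$ the function $$\theta\mapsto h^{N,q}(\lambda+i\theta)=\frac{\big(-\mathcal L(\bar\Pi+q)(\lambda+i\theta)\big)^N}{\delta^{N+1}\big(1+\frac1\delta\mathcal L(\bar\Pi+q)(\lambda+i\theta)\big)},\qquad \theta\in\mathbb R,$$ is well defined (the Laplace transform converges absolutely and the denominator does not vanish) and absolutely integrable over $\mathbb R$, and for every $x>0$ $$\big(u^{(q)}\big)'(x\pm)=-\frac{\bar\Pi(x\pm)+q}{\delta^2}+\sum_{n=2}^{N-1}\frac{(-1)^n}{\delta^{n+1}}\big(\bar\Pi+q\big)^{*n}(x)+e^{\lambda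 x}\frac1{2\pi}\int_{-\infty}^\infty e^{i\theta x}h^{N,q}(\lambda+i\theta)\,d\theta.$$ -/

import Mathlib

open MeasureTheory Set Filter Topology
open scoped NNReal ENNReal

noncomputable section

namespace SubordinatorPotential

/-- A subordinator: a real-valued process `X = (X_t)_{t ≥ 0}` that starts from zero, has independent
and stationary increments, and almost surely has right-continuous non-decreasing paths. -/
structure IsSubordinator {Ω : Type*} [MeasurableSpace Ω] (P : Measure Ω) (X : ℝ≥0 → Ω → ℝ) :
    Prop where
  measurable : ∀ t, Measurable (X t)
  start_zero : ∀ᵐ ω ∂P, X 0 ω = 0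
  indep_increments : ProbabilityTheory.HasIndepIncrements X P
  stationary_increments : ∀ s t : ℝ≥0, P.map (fun ω => X (s + t) ω - X s ω) = P.map (X t)
  right_continuous : ∀ᵐ ω ∂P, ∀ t, ContinuousWithinAt (fun s => X s ω) (Ici t) t
  nondecreasing : ∀ᵐ ω ∂P, Monotone fun t => X t ω

/-- A Lévy measure of a subordinator: a measure concentrated on `(0, ∞)` with
`∫ (1 ∧ x) Π(dx) < ∞`. -/
structure IsLevyMeasure (Pi : Measure ℝ) : Prop where
  concentrated : Pi (Iic 0) = 0
  integrable_min : ∫⁻ x, ENNReal.ofReal (min 1 x) ∂Pi < ∞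

/-- The Laplace exponent `ψ(r) = δ r + ∫_{(0,∞)} (1 - e^{-r x}) Π(dx)`. -/
def laplaceExponent (δ : ℝ) (Pi : Measure ℝ) (r : ℝ) : ℝ :=
  δ * r + ∫ x in Ioi (0 : ℝ), (1 - Real.exp (-(r * x))) ∂Pi

/-- `X` is a subordinator with drift `δ` and Lévy measure `Pi`, that is, these are its
characteristics in the Lévy-Khintchine formula `E[e^{-r X_t}] = e^{-t ψ(r)}`. -/
structure IsSubordinatorWith {Ω : Type*} [MeasurableSpace Ω] (P : Measure Ω) (X : ℝ≥0 → Ω → ℝ)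
    (δ : ℝ) (Pi : Measure ℝ) : Prop where
  isSubordinator : IsSubordinator P X
  isLevyMeasure : IsLevyMeasure Pi
  laplace : ∀ (t : ℝ≥0) (r : ℝ), 0 ≤ r →
    ∫ ω, Real.exp (-(r * X t ω)) ∂P = Real.exp (-((t : ℝ) * laplaceExponent δ Pi r))

/-- The `q`-potential measure `U^{(q)}(dx) = E [∫_0^∞ e^{-q t} 1_{X_t ∈ dx} dt]`: the image under
`(ω, t) ↦ X_t(ω)` of the measure `e^{-q t} P(dω) dt` on `Ω × [0, ∞)`. -/
def potentialMeasure {Ω : Type*} [MeasurableSpace Ω] (P : Measure Ω) (X : ℝ≥0 → Ω → ℝ) (q : ℝ) :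
    Measure ℝ :=
  ((P.prod (volume.restrict (Ici (0 : ℝ)))).withDensity
    fun z => ENNReal.ofReal (Real.exp (-(q * z.2)))).map fun z => X z.2.toNNReal z.1

/-- `u` is the continuous density on `(0, ∞)` of the `q`-potential measure. -/
structure IsPotentialDensity {Ω : Type*} [MeasurableSpace Ω] (P : Measure Ω) (X : ℝ≥0 → Ω → ℝ)
    (q : ℝ) (u : ℝ → ℝ) : Prop where
  nonneg : ∀ x, 0 < x → 0 ≤ u x
  continuousOn : ContinuousOn u (Ioi 0)
  density : potentialMeasure P X q =
    (volume.restrict (Ioi (0 : ℝ))).withDensity fun x => ENNReal.ofReal (u x)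

/-- The tail of the Lévy measure, `Π([x, ∞))` for `x > 0` and `0` for `x ≤ 0`. -/
def tail (Pi : Measure ℝ) (x : ℝ) : ℝ := if 0 < x then (Pi (Ici x)).toReal else 0

/-- The function "tail plus `q`" on `(0, ∞)`, extended by `0` to `(-∞, 0]`. -/
def tailAdd (Pi : Measure ℝ) (q x : ℝ) : ℝ := if 0 < x then tail Pi x + q else 0

/-- The convolution `(f ∗ g)(x) = ∫_0^x f(x - y) g(y) dy`. -/
def conv (f g : ℝ → ℝ) (x : ℝ) : ℝ := ∫ y in (0 : ℝ)..x, f (x - y) * g y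

/-- The convolution powers `f^{∗n}`, `n ≥ 1`; the value at `n = 0`, where the power is not a
function, is a convention that is never used. -/
def convPow (f : ℝ → ℝ) : ℕ → ℝ → ℝ
  | 0 => fun _ => 0
  | 1 => f
  | n + 2 => conv (convPow f (n + 1)) f

/-- The bilateral Laplace transform `∫ e^{-s x} f(x) dx`. -/
def bilateralLaplace (f : ℝ → ℝ) (s : ℂ) : ℂ := ∫ x : ℝ, Complex.exp (-(s * x)) * (f x : ℂ)

/-- The Blumenthal-Getoor index `inf {γ > 0 : ∫_0^1 x^γ Π(dx) < ∞}`. -/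
def blumenthalGetoor (Pi : Measure ℝ) : ℝ :=
  sInf {γ : ℝ | 0 < γ ∧ ∫⁻ x in Ioc (0 : ℝ) 1, ENNReal.ofReal (x ^ γ) ∂Pi < ∞}

/-- The point `r + i θ` of the complex plane. -/
def linePoint (r θ : ℝ) : ℂ := (r : ℂ) + Complex.I * (θ : ℂ)

/-- `h^{N,q}(s) = (-L(s))^N / (δ^{N+1} (1 + L(s)/δ))`, where `L` is the Laplace transform of the
tail plus `q`. -/
def hFun (δ : ℝ) (Pi : Measure ℝ) (q : ℝ) (N : ℕ) (s : ℂ) : ℂ :=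
  (-bilateralLaplace (tailAdd Pi q) s) ^ N /
    ((δ : ℂ) ^ (N + 1) * (1 + 1 / (δ : ℂ) * bilateralLaplace (tailAdd Pi q) s))

/-- The `n`-th term `(-1)^n δ^{-(n+1)} (tail + q)^{∗n}(x)` of the series. -/
def seriesTerm (δ : ℝ) (Pi : Measure ℝ) (q x : ℝ) (n : ℕ) : ℝ :=
  (-1) ^ n / δ ^ (n + 1) * convPow (tailAdd Pi q) n x

/-- The Laplace inversion term `e^{r x} (1/2π) ∫ e^{i θ x} h^{N,q}(r + i θ) dθ`. -/
def inversionTerm (δ : ℝ) (Pi : Measure ℝ) (q : ℝ) (N : ℕ) (r x : ℝ) : ℂ :=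
  Complex.exp ((r : ℂ) * x) * (1 / (2 * (Real.pi : ℂ))) *
    ∫ θ : ℝ, Complex.exp (Complex.I * θ * x) * hFun δ Pi q N (linePoint r θ)

end SubordinatorPotential

end

/-! Write `f` for `tailAdd Pi q` and `L` for its Laplace transform. Fubini gives `q + ψ(r) = r (δ +
L(r))` (`IsLevyMeasure.add_laplaceExponent`), so the potential measure has transform `1 / (r (δ +
L(r)))`. Since `L(r) → 0`, there are `r` with `L(r) < δ`, and from there on this is `1 / (r δ)`
times a geometric series in `-L / δ`. Powers of `L` are transforms of convolution powers of `f`, and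
`1 / r` stands for integration from `0`. So the candidate density is `1 / δ` plus the primitive of
the series (`seriesDensity`), and uniqueness of Laplace transforms identifies it
(`isPotentialDensity_seriesDensity`).

Pointwise convergence rests on `mul_convPow_le`: for integrable `φ ≥ 0` with `x φ(x) ≤ C`, the
powers satisfy `x φ^{∗n}(x) ≤ n C (∫ φ)^{n-1}`. Applied to `e^{-r x} f(x)`, it bounds the series
locally uniformly by a multiple of `∑ n (L(r) / δ)^n`. From the second power on, the terms are
continuous on `(0, ∞)` (`continuousAt_convPow`), so only the term `n = 1` can jump, and the
fundamental theorem of calculus with one-sided limits gives the derivatives.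

For the second formula, `h^{N,q}` is the transform of the remainder from `N` on
(`laplace_seriesRemainder`). If `γ` is slightly above the Blumenthal-Getoor index, then `L(s) =
O(|s|^{γ-1})`, so `h^{N,q}` is integrable on vertical lines as soon as `N (1 - γ) > 1`. Fourier
inversion applies far to the right; Cauchy's theorem moves the line to any positive abscissa,
because `1 + L / δ` has no zero in the right half-plane. -/

namespace SubordinatorPotential

/-! ### Convolution powers: transforms, pointwise bounds, continuity -/

lemma conv_eq_integral {a b : ℝ → ℝ} (ha : ∀ x ≤ 0, a x = 0) (hb : ∀ x ≤ 0, b x = 0) (x : ℝ) :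
    conv a b x = ∫ y, a (x - y) * b y := by
  unfold conv
  rcases le_or_gt 0 x with hx | hx
  · rw [intervalIntegral.integral_of_le hx]
    refine setIntegral_eq_integral_of_forall_compl_eq_zero fun y hy => ?_
    rcases le_or_gt y 0 with h | h
    · rw [hb y h, mul_zero]
    · rw [ha (x - y), zero_mul]
      by_contra h'
      exact hy ⟨h, by linarith⟩
  · have h0 : ∀ y, a (x - y) * b y = 0 := fun y => by
      rcases le_or_gt y 0 with h | h
      · rw [hb y h, mul_zero]
      · rw [ha (x - y) (by linarith), zero_mul]
    simp [h0]

lemma conv_of_nonpos {a b : ℝ → ℝ} (ha : ∀ x ≤ 0, a x = 0) (hb : ∀ x ≤ 0, b x = 0) {x : ℝ}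
    (hx : x ≤ 0) : conv a b x = 0 := by
  have h0 : ∀ y, a (x - y) * b y = 0 := fun y => by
    rcases le_or_gt y 0 with h | h
    · rw [hb y h, mul_zero]
    · rw [ha (x - y) (by linarith), zero_mul]
  rw [conv_eq_integral ha hb]
  simp [h0]

/-- Fubini, by way of Mathlib's `convolution`. Both scalar fields are needed: `ℝ` for integrals of
convolution powers, `ℂ` for Laplace transforms. -/
lemma integrable_integral_mul_sub {𝕜 : Type*} [RCLike 𝕜] {A B : ℝ → 𝕜} (hA : Integrable A)
    (hB : Integrable B) :
    Integrable (fun x => ∫ y, A (x - y) * B y) ∧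
      ∫ x, ∫ y, A (x - y) * B y = (∫ x, A x) * ∫ x, B x := by
  have h : (fun x => ∫ y, A (x - y) * B y) =
      convolution B A (ContinuousLinearMap.mul 𝕜 𝕜) volume := by
    funext x
    simp [convolution_def, mul_comm]
  rw [h]
  refine ⟨hB.integrable_convolution _ hA, ?_⟩
  rw [integral_convolution _ hB hA, ContinuousLinearMap.mul_apply', mul_comm]

lemma exp_mul_conv {a b : ℝ → ℝ} (ha : ∀ x ≤ 0, a x = 0) (hb : ∀ x ≤ 0, b x = 0) (s : ℂ) (x : ℝ) :
    Complex.exp (-(s * x)) * (conv a b x : ℂ) =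
      ∫ y : ℝ, (Complex.exp (-(s * (x - y : ℝ))) * (a (x - y) : ℂ)) *
        (Complex.exp (-(s * y)) * (b y : ℂ)) := by
  rw [conv_eq_integral ha hb, ← integral_complex_ofReal, ← integral_const_mul]
  congr 1 with y
  have : -(s * (x : ℂ)) = -(s * ((x - y : ℝ) : ℂ)) + -(s * y) := by push_cast; ring
  rw [this, Complex.exp_add]
  push_cast
  ring

/-- The Laplace transform turns convolutions into products. -/
lemma bilateralLaplace_conv {a b : ℝ → ℝ} (ha : ∀ x ≤ 0, a x = 0) (hb : ∀ x ≤ 0, b x = 0) {s : ℂ}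
    (hA : Integrable fun x : ℝ => Complex.exp (-(s * x)) * (a x : ℂ))
    (hB : Integrable fun x : ℝ => Complex.exp (-(s * x)) * (b x : ℂ)) :
    Integrable (fun x : ℝ => Complex.exp (-(s * x)) * (conv a b x : ℂ)) ∧
      bilateralLaplace (conv a b) s = bilateralLaplace a s * bilateralLaplace b s := by
  have h := integrable_integral_mul_sub hA hB
  unfold bilateralLaplace
  simp_rw [exp_mul_conv ha hb]
  exact h

lemma convPow_of_nonpos {f : ℝ → ℝ} (hf : ∀ x ≤ 0, f x = 0) (n : ℕ) :
    ∀ x ≤ 0, convPow f (n + 1) x = 0 := by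
  induction n with
  | zero => exact hf
  | succ n ih => exact fun x hx => conv_of_nonpos ih hf hx

lemma convPow_nonneg {f : ℝ → ℝ} (hf : ∀ x ≤ 0, f x = 0) (h0 : ∀ x, 0 ≤ f x) (n : ℕ) :
    ∀ x, 0 ≤ convPow f (n + 1) x := by
  induction n with
  | zero => exact h0
  | succ n ih =>
    intro x
    change 0 ≤ conv (convPow f (n + 1)) f x
    rw [conv_eq_integral (convPow_of_nonpos hf n) hf]
    exact integral_nonneg fun y => mul_nonneg (ih _) (h0 _)

lemma bilateralLaplace_convPow {f : ℝ → ℝ} (hf : ∀ x ≤ 0, f x = 0) {s : ℂ}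
    (hI : Integrable fun x : ℝ => Complex.exp (-(s * x)) * (f x : ℂ)) (n : ℕ) :
    Integrable (fun x : ℝ => Complex.exp (-(s * x)) * (convPow f (n + 1) x : ℂ)) ∧
      bilateralLaplace (convPow f (n + 1)) s = bilateralLaplace f s ^ (n + 1) := by
  induction n with
  | zero => exact ⟨hI, by simp [convPow]⟩
  | succ n ih =>
    have h := bilateralLaplace_conv (convPow_of_nonpos hf n) hf ih.1 hI
    exact ⟨h.1, by rw [pow_succ, ← ih.2, ← h.2]; rfl⟩

/-- Exponential weights commute with convolution powers. -/
lemma convPow_exp_mul {f : ℝ → ℝ} (r : ℝ) (n : ℕ) (x : ℝ) :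
    convPow (fun y => Real.exp (-(r * y)) * f y) (n + 1) x =
      Real.exp (-(r * x)) * convPow f (n + 1) x := by
  induction n generalizing x with
  | zero => rfl
  | succ n ih =>
    change conv _ _ x = _ * conv _ _ x
    unfold conv
    rw [← intervalIntegral.integral_const_mul]
    congr 1 with y
    have : -(r * x) = -(r * (x - y)) + -(r * y) := by ring
    rw [ih, this, Real.exp_add]
    ring

lemma integrable_convPow {φ : ℝ → ℝ} (hφ : ∀ x ≤ 0, φ x = 0) (hI : Integrable φ) (n : ℕ) :
    Integrable (convPow φ (n + 1)) ∧ ∫ x, convPow φ (n + 1) x = (∫ x, φ x) ^ (n + 1) := by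
  induction n with
  | zero => exact ⟨hI, by simp [convPow]⟩
  | succ n ih =>
    have h := integrable_integral_mul_sub ih.1 hI
    have e : convPow φ (n + 1 + 1) = fun x => ∫ y, convPow φ (n + 1) (x - y) * φ y := by
      funext x
      exact conv_eq_integral (convPow_of_nonpos hφ n) hφ x
    rw [e]
    exact ⟨h.1, by rw [h.2, ih.2, ← pow_succ]⟩

/-- A pointwise bound of the convolution powers of an integrable function that is `O(1 / x)`. -/
lemma mul_convPow_le {φ : ℝ → ℝ} (hφ : ∀ x ≤ 0, φ x = 0) (h0 : ∀ x, 0 ≤ φ x)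
    (hI : Integrable φ) {C : ℝ} (hC : ∀ x, x * φ x ≤ C) (n : ℕ) (x : ℝ) :
    x * convPow φ (n + 1) x ≤ (n + 1) * C * (∫ y, φ y) ^ n := by
  induction n generalizing x with
  | zero => simpa [convPow] using hC x
  | succ n ih =>
    set c := ∫ y, φ y
    have hn := integrable_convPow hφ hI n
    have hnn := convPow_nonneg hφ h0 n
    have hRHS : ∫ y, ((n + 1) * C * c ^ n * φ y + C * convPow φ (n + 1) (x - y)) =
        ((n + 1 : ℕ) + 1) * C * c ^ (n + 1) := by
      rw [integral_add (hI.const_mul _) ((hn.1.comp_sub_left x).const_mul _), integral_const_mul,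
        integral_const_mul, integral_sub_left_eq_self (convPow φ (n + 1)) volume x, hn.2]
      push_cast
      ring
    -- Splitting `x = (x - y) + y` makes multiplication by `x` a derivation of the convolution: the
    -- induction hypothesis controls one summand, `hC` the other.
    have hb : ∀ y, x * (convPow φ (n + 1) (x - y) * φ y) ≤
        (n + 1) * C * c ^ n * φ y + C * convPow φ (n + 1) (x - y) := fun y => by
      have h1 := mul_le_mul_of_nonneg_right (ih (x - y)) (h0 y)
      have h2 := mul_le_mul_of_nonneg_right (hC y) (hnn (x - y))
      nlinarith
    rw [← hRHS]
    rcases le_or_gt x 0 with hx | hx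
    · rw [convPow_of_nonpos hφ (n + 1) x hx, mul_zero]
      refine integral_nonneg fun y => ?_
      have hC0 : 0 ≤ C := by simpa [hφ 0 le_rfl] using hC 0
      have hc0 : 0 ≤ c := integral_nonneg h0
      have := h0 y
      have := hnn (x - y)
      positivity
    · change x * conv (convPow φ (n + 1)) φ x ≤ _
      rw [conv_eq_integral (convPow_of_nonpos hφ n) hφ, ← integral_const_mul]
      refine integral_mono_of_nonneg (ae_of_all _ fun y =>
        mul_nonneg hx.le (mul_nonneg (hnn _) (h0 _))) ?_ (ae_of_all _ hb)
      exact (hI.const_mul _).add ((hn.1.comp_sub_left x).const_mul _)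

/-- Dominated convergence. Reflections and translations preserve null sets, so `y ↦ b (x₀ - y)`
meets the discontinuities of `b` only on a null set. -/
lemma continuousAt_integral_mul_sub {a b : ℝ → ℝ} (ha : Integrable a)
    (hbm : AEStronglyMeasurable b) {K : ℝ} (hK : ∀ x, |b x| ≤ K) (hbc : ∀ᵐ x, ContinuousAt b x)
    (x₀ : ℝ) : ContinuousAt (fun x => ∫ y, b (x - y) * a y) x₀ := by
  refine continuousAt_of_dominated (bound := fun y => K * |a y|) (Eventually.of_forall fun x => ?_)
    (Eventually.of_forall fun x => ae_of_all _ fun y => ?_) (ha.abs.const_mul _) ?_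
  · exact (hbm.comp_quasiMeasurePreserving
      (quasiMeasurePreserving_sub_left volume x)).mul ha.aestronglyMeasurable
  · rw [norm_mul, Real.norm_eq_abs, Real.norm_eq_abs]
    exact mul_le_mul_of_nonneg_right (hK _) (abs_nonneg _)
  · filter_upwards [(quasiMeasurePreserving_sub_left volume x₀).ae hbc] with y hy
    exact (ContinuousAt.comp (f := fun x : ℝ => x - y) hy (by fun_prop)).mul continuousAt_const

/-- The convolution of two integrable, almost everywhere continuous functions that are `O(1 / x)` is
continuous on `(0, ∞)`. -/
lemma continuousAt_conv {a b : ℝ → ℝ} (ha : ∀ x ≤ 0, a x = 0) (hb : ∀ x ≤ 0, b x = 0)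
    (ha0 : ∀ x, 0 ≤ a x) (hb0 : ∀ x, 0 ≤ b x) (hai : Integrable a) (hbi : Integrable b)
    (hac : ∀ᵐ x, ContinuousAt a x) (hbc : ∀ᵐ x, ContinuousAt b x) {K : ℝ}
    (hKa : ∀ x, x * a x ≤ K) (hKb : ∀ x, x * b x ≤ K) {x₀ : ℝ} (hx₀ : 0 < x₀) :
    ContinuousAt (conv a b) x₀ := by
  have key : ∀ {g : ℝ → ℝ} {m : ℝ}, 0 < m → (∀ x, 0 ≤ g x) → Integrable g →
      (∀ᵐ x, ContinuousAt g x) → (∀ x, x * g x ≤ K) →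
      (∀ x, |(Ici m).indicator g x| ≤ K / m) ∧
        ∀ᵐ x, ContinuousAt ((Ici m).indicator g) x := by
    intro g m hm hg0 hgi hgc hgK
    refine ⟨fun x => ?_, ?_⟩
    · by_cases hx : x ∈ Ici m
      · rw [indicator_of_mem hx, abs_of_nonneg (hg0 x), le_div_iff₀ hm]
        have := mul_le_mul_of_nonneg_right (mem_Ici.1 hx) (hg0 x)
        linarith [hgK x]
      · rw [indicator_of_notMem hx, abs_zero]
        have hK0 : 0 ≤ K := by simpa using hgK 0
        positivity
    · filter_upwards [hgc, compl_mem_ae_iff.2 (measure_singleton m)] with x hx hxm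
      rcases lt_or_gt_of_ne hxm with h | h
      · have : (Ici m).indicator g =ᶠ[𝓝 x] fun _ => 0 := by
          filter_upwards [Iio_mem_nhds h] with y hy
          exact indicator_of_notMem (by simpa using hy) _
        exact continuousAt_const.congr this.symm
      · have : (Ici m).indicator g =ᶠ[𝓝 x] g := by
          filter_upwards [Ioi_mem_nhds h] with y hy
          exact indicator_of_mem (mem_Ici.2 (le_of_lt hy)) _
        exact hx.congr this.symm
  -- Both factors may blow up at `0`, but not at the same `y`: for `x` near `x₀`, either `y ≥ m` or
  -- `x - y ≥ m / 2`. Cutting at `m` leaves in each piece one factor that is bounded and almost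
  -- everywhere continuous.
  set m := x₀ / 2 with hm
  have hm0 : 0 < m := by positivity
  have hm2 : 0 < m / 2 := by positivity
  obtain ⟨hb1, hb2⟩ := key hm0 hb0 hbi hbc hKb
  obtain ⟨ha1, ha2⟩ := key hm2 ha0 hai hac hKa
  have hbi2 : Integrable ((Ici m).indicator b) := hbi.indicator measurableSet_Ici
  have hbi1 : Integrable ((Iio m).indicator b) := hbi.indicator measurableSet_Iio
  have hai2 : Integrable ((Ici (m / 2)).indicator a) := hai.indicator measurableSet_Ici
  have c1 := continuousAt_integral_mul_sub hai hbi2.aestronglyMeasurable hb1 hb2 x₀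
  have c2 := continuousAt_integral_mul_sub hbi1 hai2.aestronglyMeasurable ha1 ha2 x₀
  refine (c2.add c1).congr ?_
  filter_upwards [Ioo_mem_nhds (show x₀ - m / 2 < x₀ by linarith) (show x₀ < x₀ + 1 by linarith)]
    with x hx
  rw [conv_eq_integral ha hb]
  have hint1 : Integrable fun y => (Ici (m / 2)).indicator a (x - y) * (Iio m).indicator b y :=
    hbi1.bdd_mul (hai2.comp_sub_left x).aestronglyMeasurable (ae_of_all _ fun y => ha1 _)
  have hint2 : Integrable fun y => (Ici m).indicator b (x - y) * a y :=
    hai.bdd_mul (hbi2.comp_sub_left x).aestronglyMeasurable (ae_of_all _ fun y => hb1 _)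
  have e2 : ∫ y, (Ici m).indicator b (x - y) * a y = ∫ y, a (x - y) * (Ici m).indicator b y := by
    rw [← integral_sub_left_eq_self (fun y => a (x - y) * (Ici m).indicator b y) volume x]
    simp [mul_comm]
  have hint3 : Integrable fun y => a (x - y) * (Ici m).indicator b y := by
    simpa [mul_comm] using hint2.comp_sub_left x
  rw [Pi.add_apply, e2, ← integral_add hint1 hint3]
  refine integral_congr_ae (ae_of_all _ fun y => ?_)
  simp only
  rcases lt_or_ge y m with hy | hy
  · have h1 : m / 2 ≤ x - y := by linarith [hx.1]
    rw [indicator_of_mem (show y ∈ Iio m from hy), indicator_of_notMem (a := y) (by simpa using hy),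
      indicator_of_mem (show x - y ∈ Ici (m / 2) from h1)]
    ring
  · rw [indicator_of_mem (show y ∈ Ici m from hy), indicator_of_notMem (a := y) (by simpa using hy)]
    ring

/-- Each convolution upgrades almost everywhere continuity to continuity off the origin, which is
what the next convolution needs. The index starts at `2` because `φ` itself may jump. -/
lemma continuousAt_convPow {φ : ℝ → ℝ} (hφ : ∀ x ≤ 0, φ x = 0) (h0 : ∀ x, 0 ≤ φ x)
    (hI : Integrable φ) (hc : ∀ᵐ x, ContinuousAt φ x) {C : ℝ} (hC : ∀ x, x * φ x ≤ C) (n : ℕ)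
    {x : ℝ} (hx : 0 < x) : ContinuousAt (convPow φ (n + 2)) x := by
  have step : ∀ m, (∀ᵐ x, ContinuousAt (convPow φ (m + 1)) x) → ∀ x, 0 < x →
      ContinuousAt (convPow φ (m + 2)) x := fun m hm x hx =>
    continuousAt_conv (convPow_of_nonpos hφ m) hφ (convPow_nonneg hφ h0 m) h0
      (integrable_convPow hφ hI m).1 hI hm hc
      (fun x => (mul_convPow_le hφ h0 hI hC m x).trans (le_max_left _ C))
      (fun x => (hC x).trans (le_max_right _ _)) hx
  have ae : ∀ m, ∀ᵐ x, ContinuousAt (convPow φ (m + 1)) x := by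
    intro m
    induction m with
    | zero => exact hc
    | succ m ih =>
      filter_upwards [compl_mem_ae_iff.2 (measure_singleton (0 : ℝ))] with x hx
      rcases lt_or_gt_of_ne hx with h | h
      · have : convPow φ (m + 1 + 1) =ᶠ[𝓝 x] fun _ => 0 := by
          filter_upwards [Iio_mem_nhds h] with y hy
          exact convPow_of_nonpos hφ _ y (le_of_lt hy)
        exact continuousAt_const.congr this.symm
      · exact step m ih x h
  exact step n (ae n) x hx

/-! ### Lévy measures, their tails and the Laplace transform of the tail -/

/-- The Laplace transform at a real point, as a real number. -/
noncomputable def realLaplace (f : ℝ → ℝ) (r : ℝ) : ℝ := ∫ x, Real.exp (-(r * x)) * f x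

lemma bilateralLaplace_ofReal (f : ℝ → ℝ) (r : ℝ) :
    bilateralLaplace f (r : ℂ) = (realLaplace f r : ℂ) := by
  unfold bilateralLaplace realLaplace
  rw [← integral_complex_ofReal]
  congr 1 with x
  push_cast
  rfl

lemma integrable_exp_mul_of_complex {f : ℝ → ℝ} {r : ℝ}
    (h : Integrable fun x : ℝ => Complex.exp (-((r : ℂ) * x)) * (f x : ℂ)) :
    Integrable fun x => Real.exp (-(r * x)) * f x := by
  refine h.re.congr (ae_of_all _ fun x => ?_)
  have : Complex.exp (-((r : ℂ) * x)) * (f x : ℂ) = ((Real.exp (-(r * x)) * f x : ℝ) : ℂ) := by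
    push_cast
    rfl
  simp only [this]
  exact Complex.ofReal_re _

/-- Markov's inequality for `1 ∧ y`. -/
lemma IsLevyMeasure.measure_Ici_lt_top {Pi : Measure ℝ} (hPi : IsLevyMeasure Pi) {x : ℝ}
    (hx : 0 < x) : Pi (Ici x) < ∞ := by
  have hm : 0 < min 1 x := by positivity
  have h := meas_ge_le_lintegral_div (μ := Pi) (f := fun y => ENNReal.ofReal (min 1 y))
    (by fun_prop) (ε := ENNReal.ofReal (min 1 x)) (by simpa using hx) ENNReal.ofReal_ne_top
  refine ((measure_mono fun y hy => ?_).trans h).trans_lt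
    (ENNReal.div_lt_top hPi.integrable_min.ne (by simpa using hx))
  exact ENNReal.ofReal_le_ofReal (min_le_min_left _ hy)

lemma IsLevyMeasure.sigmaFinite {Pi : Measure ℝ} (hPi : IsLevyMeasure Pi) : SigmaFinite Pi := by
  refine ⟨⟨⟨fun n : ℕ => Iic 0 ∪ Ici (1 / ((n : ℝ) + 1)), fun _ => trivial, fun n => ?_, ?_⟩⟩⟩
  · refine (measure_union_le _ _).trans_lt ?_
    rw [hPi.concentrated, zero_add]
    exact hPi.measure_Ici_lt_top Nat.one_div_pos_of_nat
  · refine eq_univ_of_forall fun x => mem_iUnion.2 ?_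
    rcases le_or_gt x 0 with h | h
    · exact ⟨0, Or.inl h⟩
    · obtain ⟨n, hn⟩ := exists_nat_one_div_lt h
      exact ⟨n, Or.inr hn.le⟩

lemma IsLevyMeasure.ae_pos {Pi : Measure ℝ} (hPi : IsLevyMeasure Pi) : ∀ᵐ x ∂Pi, 0 < x := by
  rw [ae_iff]
  convert hPi.concentrated using 2
  ext x
  simp

lemma IsLevyMeasure.integrable_min_one {Pi : Measure ℝ} (hPi : IsLevyMeasure Pi) :
    Integrable (fun x => min 1 x) Pi := by
  refine ⟨by fun_prop, ?_⟩
  rw [hasFiniteIntegral_iff_ofReal]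
  · exact hPi.integrable_min
  · filter_upwards [hPi.ae_pos] with x hx
    exact (lt_min one_pos hx).le

/-- This one bound yields both integrability against a Lévy measure and, later, the decay of the
transform of the tail. -/
lemma norm_one_sub_exp_neg_le {z : ℂ} (hz : 0 ≤ z.re) :
    ‖1 - Complex.exp (-z)‖ ≤ 2 * min 1 ‖z‖ := by
  rcases le_total ‖z‖ 1 with h | h
  · rw [min_eq_right h, norm_sub_rev]
    simpa using Complex.norm_exp_sub_one_le (x := -z) (by simpa using h)
  · rw [min_eq_left h]
    refine (norm_sub_le _ _).trans ?_
    have : ‖Complex.exp (-z)‖ ≤ 1 := by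
      rw [Complex.norm_exp]
      simpa using hz
    simp only [norm_one]
    linarith

lemma IsLevyMeasure.integrable_one_sub_exp {Pi : Measure ℝ} (hPi : IsLevyMeasure Pi) {s : ℂ}
    (hs : 0 ≤ s.re) : Integrable (fun x : ℝ => 1 - Complex.exp (-(s * x))) Pi := by
  refine (hPi.integrable_min_one.const_mul (2 * max 1 ‖s‖)).mono' (by fun_prop) ?_
  filter_upwards [hPi.ae_pos] with x hx
  refine (norm_one_sub_exp_neg_le ?_).trans ?_
  · simpa using mul_nonneg hs hx.le
  · rw [norm_mul, Complex.norm_real, Real.norm_of_nonneg hx.le, mul_assoc]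
    gcongr
    rw [mul_min_of_nonneg _ _ (by positivity), mul_one]
    exact min_le_min (le_max_left _ _) (by gcongr; exact le_max_right _ _)

lemma tail_of_nonpos {Pi : Measure ℝ} {x : ℝ} (hx : x ≤ 0) : tail Pi x = 0 := by
  simp [tail, hx.not_gt]

lemma tail_nonneg (Pi : Measure ℝ) (x : ℝ) : 0 ≤ tail Pi x := by
  unfold tail
  split_ifs
  exacts [ENNReal.toReal_nonneg, le_rfl]

lemma tailAdd_of_nonpos {Pi : Measure ℝ} {q x : ℝ} (hx : x ≤ 0) : tailAdd Pi q x = 0 := by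
  simp [tailAdd, hx.not_gt]

lemma tailAdd_of_pos {Pi : Measure ℝ} {q x : ℝ} (hx : 0 < x) :
    tailAdd Pi q x = tail Pi x + q := by
  simp [tailAdd, hx]

lemma tailAdd_nonneg (Pi : Measure ℝ) {q : ℝ} (hq : 0 ≤ q) (x : ℝ) : 0 ≤ tailAdd Pi q x := by
  unfold tailAdd
  split_ifs
  exacts [add_nonneg (tail_nonneg _ _) hq, le_rfl]

lemma tailAdd_eq_add_indicator (Pi : Measure ℝ) (q x : ℝ) :
    tailAdd Pi q x = tail Pi x + (Ioi 0).indicator (fun _ => q) x := by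
  rcases le_or_gt x 0 with h | h
  · simp [tailAdd_of_nonpos h, tail_of_nonpos h, h]
  · simp [tailAdd_of_pos h, h]

lemma IsLevyMeasure.antitoneOn_tail {Pi : Measure ℝ} (hPi : IsLevyMeasure Pi) :
    AntitoneOn (tail Pi) (Ioi 0) := by
  intro x hx y hy hxy
  simp only [tail, if_pos (mem_Ioi.1 hx), if_pos (mem_Ioi.1 hy)]
  exact ENNReal.toReal_mono (hPi.measure_Ici_lt_top hx).ne (measure_mono (Ici_subset_Ici.2 hxy))

lemma IsLevyMeasure.antitoneOn_tailAdd {Pi : Measure ℝ} (hPi : IsLevyMeasure Pi) (q : ℝ) :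
    AntitoneOn (tailAdd Pi q) (Ioi 0) := by
  intro x hx y hy hxy
  rw [tailAdd_of_pos hx, tailAdd_of_pos hy]
  linarith [hPi.antitoneOn_tail hx hy hxy]

/-- The tail is monotone only on `(0, ∞)`. Freezing it below `m` makes it antitone on the whole line
without changing it near points above `m`, so results on monotone functions apply. -/
lemma antitone_comp_max_of_antitoneOn {f : ℝ → ℝ} (hf : AntitoneOn f (Ioi 0)) {m : ℝ}
    (hm : 0 < m) : Antitone fun y => f (max y m) := fun _ _ hxy =>
  hf (lt_max_of_lt_right hm) (lt_max_of_lt_right hm) (max_le_max_right _ hxy)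

lemma comp_max_eventuallyEq (f : ℝ → ℝ) {m x : ℝ} (h : m < x) :
    (fun y => f (max y m)) =ᶠ[𝓝 x] f := by
  filter_upwards [Ioi_mem_nhds h] with y hy
  rw [max_eq_left (le_of_lt hy)]

lemma tendsto_rightLim_of_antitoneOn {f : ℝ → ℝ} (hf : AntitoneOn f (Ioi 0)) {x : ℝ}
    (hx : 0 < x) : Tendsto f (𝓝[>] x) (𝓝 (Function.rightLim f x)) :=
  tendsto_rightLim_of_tendsto ⟨_, ((antitone_comp_max_of_antitoneOn hf (half_pos hx)).tendsto_rightLim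
    x).congr' ((comp_max_eventuallyEq f (half_lt_self hx)).filter_mono nhdsWithin_le_nhds)⟩

lemma tendsto_leftLim_of_antitoneOn {f : ℝ → ℝ} (hf : AntitoneOn f (Ioi 0)) {x : ℝ}
    (hx : 0 < x) : Tendsto f (𝓝[<] x) (𝓝 (Function.leftLim f x)) :=
  tendsto_leftLim_of_tendsto ⟨_, ((antitone_comp_max_of_antitoneOn hf (half_pos hx)).tendsto_leftLim
    x).congr' ((comp_max_eventuallyEq f (half_lt_self hx)).filter_mono nhdsWithin_le_nhds)⟩

lemma ae_continuousAt_of_antitoneOn {f : ℝ → ℝ} (h0 : ∀ x ≤ 0, f x = 0)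
    (hf : AntitoneOn f (Ioi 0)) : ∀ᵐ x, ContinuousAt f x := by
  have h : ∀ n : ℕ, ∀ᵐ x : ℝ, ContinuousAt (fun y => f (max y (1 / ((n : ℝ) + 1)))) x := fun n =>
    (antitone_comp_max_of_antitoneOn hf
      Nat.one_div_pos_of_nat).countable_not_continuousAt.measure_zero _
  filter_upwards [ae_all_iff.2 h, compl_mem_ae_iff.2 (measure_singleton (0 : ℝ))] with x hx hx0
  rcases lt_or_gt_of_ne hx0 with h' | h'
  · have : f =ᶠ[𝓝 x] fun _ => 0 := by
      filter_upwards [Iio_mem_nhds h'] with y hy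
      exact h0 y (le_of_lt hy)
    exact continuousAt_const.congr this.symm
  · obtain ⟨n, hn⟩ := exists_nat_one_div_lt h'
    exact (hx n).congr (comp_max_eventuallyEq f hn)

lemma integral_exp_neg_mul {s : ℂ} (hs : s ≠ 0) (x : ℝ) :
    ∫ y in (0 : ℝ)..x, Complex.exp (-(s * y)) = (1 - Complex.exp (-(s * x))) / s := by
  have h := integral_exp_mul_complex (a := 0) (b := x) (neg_ne_zero.2 hs)
  simp only [neg_mul] at h
  rw [h]
  simp only [Complex.ofReal_zero, mul_zero, neg_zero, Complex.exp_zero]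
  rw [div_neg, ← neg_div, neg_sub]

lemma norm_exp_neg_mul (s : ℂ) (x : ℝ) :
    ‖Complex.exp (-(s * x))‖ = Real.exp (-(s.re * x)) := by
  simp [Complex.norm_exp]

/-- The Laplace transform of the tail of a Lévy measure. -/
lemma IsLevyMeasure.laplace_tail {Pi : Measure ℝ} (hPi : IsLevyMeasure Pi) {s : ℂ}
    (hs : 0 < s.re) :
    Integrable (fun x : ℝ => Complex.exp (-(s * x)) * (tail Pi x : ℂ)) ∧
      s * bilateralLaplace (tail Pi) s = ∫ x : ℝ, (1 - Complex.exp (-(s * x))) ∂Pi := by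
  have hsf := hPi.sigmaFinite
  have hs0 : s ≠ 0 := fun h => by simp [h] at hs
  -- Fubini on `0 < y ≤ x`: integrating `e^{-s y}` over `y` gives `(1 - e^{-s x}) / s`, integrating
  -- over `x` against `Pi` gives `e^{-s y}` times the tail at `y`.
  set T : Set (ℝ × ℝ) := {p | 0 < p.1 ∧ p.1 ≤ p.2} with hT
  have hTm : MeasurableSet T :=
    (measurableSet_lt measurable_const measurable_fst).inter
      (measurableSet_le measurable_fst measurable_snd)
  set G : ℝ × ℝ → ℂ := T.indicator fun p => Complex.exp (-(s * p.1)) with hG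
  have hGm : AEStronglyMeasurable G (volume.prod Pi) :=
    (by fun_prop : Continuous fun p : ℝ × ℝ => Complex.exp (-(s * p.1))).aestronglyMeasurable.indicator
      hTm
  have sec1 : ∀ x : ℝ, (fun y => G (y, x)) =
      (Ioc 0 x).indicator fun y : ℝ => Complex.exp (-(s * y)) := fun x => by
    funext y
    by_cases h : y ∈ Ioc 0 x
    · rw [indicator_of_mem h]; exact indicator_of_mem (s := T) h _
    · rw [indicator_of_notMem h]; exact indicator_of_notMem (s := T) h _
  have sec1n : ∀ x : ℝ, (fun y => ‖G (y, x)‖) =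
      (Ioc 0 x).indicator fun y : ℝ => Real.exp (-(s.re * y)) := fun x => by
    funext y
    rw [show G (y, x) = _ from congrFun (sec1 x) y, norm_indicator_eq_indicator_norm]
    simp only [norm_exp_neg_mul]
  have sec2 : ∀ y : ℝ, ∫ x, G (y, x) ∂Pi = Complex.exp (-(s * y)) * (tail Pi y : ℂ) := fun y => by
    rcases le_or_gt y 0 with hy | hy
    · have : ∀ x, G (y, x) = 0 := fun x => indicator_of_notMem (fun h => hy.not_gt h.1) _
      simp [this, tail_of_nonpos hy]
    · have : (fun x => G (y, x)) = (Ici y).indicator fun _ => Complex.exp (-(s * y)) := by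
        funext x
        by_cases h : x ∈ Ici y
        · rw [indicator_of_mem h]; exact indicator_of_mem (s := T) (a := (y, x)) ⟨hy, h⟩ _
        · rw [indicator_of_notMem h]; exact indicator_of_notMem (s := T) (a := (y, x)) (fun h' => h h'.2) _
      rw [this, integral_indicator measurableSet_Ici, setIntegral_const]
      simp [tail, hy, Measure.real, mul_comm]
  have hint : ∀ x : ℝ, ∫ y, G (y, x) = (if 0 < x then (1 - Complex.exp (-(s * x))) / s else 0) :=
    fun x => by
    rw [sec1, integral_indicator measurableSet_Ioc]
    split_ifs with h
    · rw [← intervalIntegral.integral_of_le h.le, integral_exp_neg_mul hs0]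
    · rw [Ioc_eq_empty (by simpa using h)]
      simp
  have hGi : Integrable G (volume.prod Pi) := by
    rw [integrable_prod_iff' hGm]
    refine ⟨ae_of_all _ fun x => ?_, ?_⟩
    · rw [sec1, integrable_indicator_iff measurableSet_Ioc]
      exact (by fun_prop : Continuous fun y : ℝ => Complex.exp (-(s * y))).integrableOn_Ioc
    · refine ((hPi.integrable_one_sub_exp (s := (s.re : ℂ)) hs.le).re.const_mul
        (s.re)⁻¹).congr ?_
      filter_upwards [hPi.ae_pos] with x hx
      rw [sec1n, integral_indicator measurableSet_Ioc, ← intervalIntegral.integral_of_le hx.le]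
      have h := integral_exp_neg_mul (s := (s.re : ℂ)) (by exact_mod_cast hs.ne') x
      have e : ∀ y : ℝ, Complex.exp (-((s.re : ℂ) * y)) = ((Real.exp (-(s.re * y)) : ℝ) : ℂ) :=
        fun y => by push_cast; rfl
      simp_rw [e] at h ⊢
      rw [intervalIntegral.integral_ofReal] at h
      have h' : ∫ y in (0 : ℝ)..x, Real.exp (-(s.re * y)) = (1 - Real.exp (-(s.re * x))) / s.re := by
        exact_mod_cast h
      rw [h', div_eq_inv_mul]
      congr 1
  refine ⟨?_, ?_⟩
  · have := hGi.integral_prod_left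
    simp_rw [sec2] at this
    exact this
  · unfold bilateralLaplace
    simp_rw [← sec2]
    rw [integral_integral_swap (f := fun y x => G (y, x)) hGi, ← integral_const_mul]
    refine integral_congr_ae ?_
    filter_upwards [hPi.ae_pos] with x hx
    rw [hint, if_pos hx, mul_div_cancel₀ _ hs0]

/-- The Laplace transform of the tail plus `q`. -/
lemma IsLevyMeasure.laplace_tailAdd {Pi : Measure ℝ} (hPi : IsLevyMeasure Pi) (q : ℝ) {s : ℂ}
    (hs : 0 < s.re) :
    Integrable (fun x : ℝ => Complex.exp (-(s * x)) * (tailAdd Pi q x : ℂ)) ∧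
      s * bilateralLaplace (tailAdd Pi q) s =
        (∫ x : ℝ, (1 - Complex.exp (-(s * x))) ∂Pi) + q := by
  have hs0 : s ≠ 0 := fun h => by simp [h] at hs
  obtain ⟨h1, h2⟩ := hPi.laplace_tail hs
  have e : ∀ x : ℝ, Complex.exp (-(s * x)) * (tailAdd Pi q x : ℂ) =
      Complex.exp (-(s * x)) * (tail Pi x : ℂ) +
        (Ioi 0).indicator (fun y : ℝ => Complex.exp (-s * y) * q) x := fun x => by
    rw [tailAdd_eq_add_indicator]
    push_cast
    rw [mul_add]
    congr 1
    by_cases h : x ∈ Ioi 0 <;> simp [h]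
  have hi : IntegrableOn (fun y : ℝ => Complex.exp (-s * y) * q) (Ioi 0) :=
    (integrableOn_exp_mul_complex_Ioi (by simpa using hs) 0).mul_const _
  have hi' := (integrable_indicator_iff measurableSet_Ioi).2 hi
  refine ⟨(h1.add hi').congr (ae_of_all _ fun x => (e x).symm), ?_⟩
  unfold bilateralLaplace
  simp_rw [e]
  rw [integral_add h1 hi', integral_indicator measurableSet_Ioi, integral_mul_const,
    integral_exp_mul_complex_Ioi (by simpa using hs) 0, mul_add, ← h2]
  congr 1
  simp
  field_simp

lemma IsLevyMeasure.integrable_exp_mul_tailAdd {Pi : Measure ℝ} (hPi : IsLevyMeasure Pi) (q : ℝ)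
    {r : ℝ} (hr : 0 < r) : Integrable fun x => Real.exp (-(r * x)) * tailAdd Pi q x :=
  integrable_exp_mul_of_complex (hPi.laplace_tailAdd q (s := (r : ℂ)) hr).1

/-- The integrand is non-increasing on `(0, ∞)`, so the rectangle of width `x` and height its value
at `x` lies under its graph. -/
lemma IsLevyMeasure.mul_exp_mul_tailAdd_le {Pi : Measure ℝ} (hPi : IsLevyMeasure Pi) {q : ℝ}
    (hq : 0 ≤ q) {r : ℝ} (hr : 0 < r) (x : ℝ) :
    x * (Real.exp (-(r * x)) * tailAdd Pi q x) ≤ realLaplace (tailAdd Pi q) r := by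
  have hI := hPi.integrable_exp_mul_tailAdd q hr
  have h0 : ∀ y, 0 ≤ Real.exp (-(r * y)) * tailAdd Pi q y := fun y =>
    mul_nonneg (Real.exp_nonneg _) (tailAdd_nonneg Pi hq y)
  rcases le_or_gt x 0 with hx | hx
  · rw [tailAdd_of_nonpos hx, mul_zero, mul_zero]
    exact integral_nonneg h0
  · have h1 : ∫ _ in Ioc 0 x, Real.exp (-(r * x)) * tailAdd Pi q x =
        x * (Real.exp (-(r * x)) * tailAdd Pi q x) := by
      rw [setIntegral_const]
      simp [hx.le]
    rw [← h1]
    refine (setIntegral_mono_on (integrableOn_const (by simp)) hI.integrableOn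
      measurableSet_Ioc fun y hy => ?_).trans (setIntegral_le_integral hI (ae_of_all _ h0))
    have := hPi.antitoneOn_tailAdd q hy.1 hx hy.2
    have := tailAdd_nonneg Pi hq x
    gcongr
    exact hy.2

lemma IsLevyMeasure.tendsto_realLaplace_tailAdd {Pi : Measure ℝ} (hPi : IsLevyMeasure Pi) {q : ℝ}
    (hq : 0 ≤ q) : Tendsto (realLaplace (tailAdd Pi q)) atTop (𝓝 0) := by
  have : (0 : ℝ) = ∫ _ : ℝ, (0 : ℝ) := by simp
  rw [this]
  refine tendsto_integral_filter_of_dominated_convergence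
    (fun x => Real.exp (-(1 * x)) * tailAdd Pi q x) ?_ ?_
    (hPi.integrable_exp_mul_tailAdd q one_pos) (ae_of_all _ fun x => ?_)
  · filter_upwards [Ioi_mem_atTop 0] with r hr
    exact (hPi.integrable_exp_mul_tailAdd q hr).aestronglyMeasurable
  · filter_upwards [Ici_mem_atTop 1] with r hr
    refine ae_of_all _ fun x => ?_
    have h0 := tailAdd_nonneg Pi hq x
    rw [Real.norm_of_nonneg (by positivity)]
    rcases le_or_gt x 0 with hx | hx
    · simp [tailAdd_of_nonpos hx]
    · gcongr
      exact hr
  · rcases le_or_gt x 0 with hx | hx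
    · simp [tailAdd_of_nonpos hx]
    · rw [← zero_mul (tailAdd Pi q x)]
      refine Tendsto.mul_const _ (Real.tendsto_exp_neg_atTop_nhds_zero.comp ?_)
      exact tendsto_id.atTop_mul_const hx

lemma IsLevyMeasure.realLaplace_tailAdd_antitoneOn {Pi : Measure ℝ} (hPi : IsLevyMeasure Pi)
    {q : ℝ} (hq : 0 ≤ q) : AntitoneOn (realLaplace (tailAdd Pi q)) (Ioi 0) := by
  intro r hr r' hr' hrr
  refine integral_mono (hPi.integrable_exp_mul_tailAdd q hr') (hPi.integrable_exp_mul_tailAdd q hr)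
    fun x => ?_
  rcases le_or_gt x 0 with hx | hx
  · simp [tailAdd_of_nonpos hx]
  · have h0 := tailAdd_nonneg Pi hq x
    simp only
    gcongr

lemma realLaplace_tailAdd_nonneg (Pi : Measure ℝ) {q : ℝ} (hq : 0 ≤ q) (r : ℝ) :
    0 ≤ realLaplace (tailAdd Pi q) r :=
  integral_nonneg fun _ => mul_nonneg (Real.exp_nonneg _) (tailAdd_nonneg Pi hq _)

/-! ### The series and its remainders: convergence, continuity, transform -/

lemma integrable_tsum_of_summable_integral_norm {F : ℕ → ℝ → ℂ} (hF : ∀ i, Integrable (F i))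
    (hs : Summable fun i => ∫ x, ‖F i x‖) (hp : ∀ x, Summable fun i => F i x) :
    Integrable fun x => ∑' i, F i x := by
  refine ⟨?_, ?_⟩
  · refine aestronglyMeasurable_of_tendsto_ae atTop (f := fun n x => ∑ i ∈ Finset.range n, F i x)
      (fun n => ?_) (ae_of_all _ fun x => (hp x).hasSum.tendsto_sum_nat)
    exact (integrable_finsetSum _ fun i _ => hF i).aestronglyMeasurable
  · have h1 : ∫⁻ x, ‖∑' i, F i x‖ₑ ≤ ∫⁻ x, ∑' i, ‖F i x‖ₑ := by
      refine lintegral_mono fun x => ?_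
      exact enorm_tsum_le_tsum_enorm
    refine h1.trans_lt ?_
    rw [lintegral_tsum fun i => (hF i).aestronglyMeasurable.enorm]
    simp_rw [← ofReal_integral_norm_eq_lintegral_enorm (hF _)]
    rw [← ENNReal.ofReal_tsum_of_nonneg (fun i => integral_nonneg fun x => norm_nonneg _) hs]
    exact ENNReal.ofReal_lt_top

/-- The remainder `∑_{n ≥ k} (-1)^n δ^{-(n+1)} (tail + q)^{∗n}(x)` of the series. -/
noncomputable def seriesRemainder (δ : ℝ) (Pi : Measure ℝ) (q : ℝ) (k : ℕ) (x : ℝ) : ℝ :=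
  ∑' j : ℕ, seriesTerm δ Pi q x (j + k)

lemma seriesTerm_of_nonpos (δ : ℝ) (Pi : Measure ℝ) (q : ℝ) {x : ℝ} (hx : x ≤ 0) (n : ℕ) :
    seriesTerm δ Pi q x (n + 1) = 0 := by
  unfold seriesTerm
  rw [convPow_of_nonpos (fun y hy => tailAdd_of_nonpos hy) n x hx, mul_zero]

section

variable {δ : ℝ} {Pi : Measure ℝ} {q : ℝ}

lemma abs_seriesTerm (hδ : 0 < δ) (hq : 0 ≤ q) (x : ℝ) (n : ℕ) :
    |seriesTerm δ Pi q x (n + 1)| = convPow (tailAdd Pi q) (n + 1) x / δ ^ (n + 2) := by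
  have := convPow_nonneg (fun y hy => tailAdd_of_nonpos hy) (tailAdd_nonneg Pi hq) n x
  unfold seriesTerm
  rw [abs_mul, abs_div, abs_pow, abs_neg, abs_one, one_pow, abs_of_nonneg this,
    abs_of_pos (by positivity)]
  ring

/-- `mul_convPow_le` for `e^{-r y} f(y)`, where the constant `C` and the total mass are both `L(r)`.
The power `^ 1` only matches the form of `summable_pow_mul_geometric_of_norm_lt_one`. -/
lemma abs_seriesTerm_le (hδ : 0 < δ) (hPi : IsLevyMeasure Pi) (hq : 0 ≤ q) {r : ℝ} (hr : 0 < r)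
    {x : ℝ} (hx : 0 < x) (n : ℕ) :
    |seriesTerm δ Pi q x (n + 1)| ≤ Real.exp (r * x) / (x * δ) *
      (((n + 1 : ℕ) : ℝ) ^ 1 * (realLaplace (tailAdd Pi q) r / δ) ^ (n + 1)) := by
  have h := mul_convPow_le (φ := fun y => Real.exp (-(r * y)) * tailAdd Pi q y)
    (fun y hy => by simp [tailAdd_of_nonpos hy])
    (fun y => mul_nonneg (Real.exp_nonneg _) (tailAdd_nonneg Pi hq y))
    (hPi.integrable_exp_mul_tailAdd q hr) (hPi.mul_exp_mul_tailAdd_le hq hr) n x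
  rw [convPow_exp_mul, Real.exp_neg] at h
  change _ ≤ _ * realLaplace (tailAdd Pi q) r ^ n at h
  rw [abs_seriesTerm hδ hq]
  set c := realLaplace (tailAdd Pi q) r
  set A := convPow (tailAdd Pi q) (n + 1) x
  have hE := Real.exp_pos (r * x)
  have hA : A ≤ Real.exp (r * x) / x * ((n + 1) * c * c ^ n) := by
    have : A = Real.exp (r * x) / x * (x * ((Real.exp (r * x))⁻¹ * A)) := by field_simp
    rw [this]
    gcongr
  calc A / δ ^ (n + 2) ≤ Real.exp (r * x) / x * ((n + 1) * c * c ^ n) / δ ^ (n + 2) := by gcongr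
    _ = _ := by
      push_cast
      rw [div_pow]
      field_simp
      ring

lemma summable_mul_geometric {ρ : ℝ} (h0 : 0 ≤ ρ) (h1 : ρ < 1) (k : ℕ) :
    Summable fun j : ℕ => (((j + k : ℕ) : ℝ) ^ 1 * ρ ^ (j + k)) :=
  (summable_nat_add_iff (f := fun n : ℕ => (n : ℝ) ^ 1 * ρ ^ n) k).2
    (summable_pow_mul_geometric_of_norm_lt_one 1 (by rwa [Real.norm_of_nonneg h0]))

lemma realLaplace_div_lt_one (hδ : 0 < δ) (hq : 0 ≤ q) {r : ℝ}
    (hrδ : realLaplace (tailAdd Pi q) r < δ) :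
    0 ≤ realLaplace (tailAdd Pi q) r / δ ∧ realLaplace (tailAdd Pi q) r / δ < 1 :=
  ⟨div_nonneg (realLaplace_tailAdd_nonneg Pi hq r) hδ.le, (div_lt_one hδ).2 hrδ⟩

/-- Provides an abscissa at which the geometric series converges. -/
lemma exists_realLaplace_lt (hδ : 0 < δ) (hPi : IsLevyMeasure Pi) (hq : 0 ≤ q) :
    ∃ r, 0 < r ∧ realLaplace (tailAdd Pi q) r < δ :=
  ((eventually_gt_atTop 0).and
    ((hPi.tendsto_realLaplace_tailAdd hq).eventually (gt_mem_nhds hδ))).exists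

lemma summable_seriesTerm (hδ : 0 < δ) (hPi : IsLevyMeasure Pi) (hq : 0 ≤ q) (k : ℕ) (x : ℝ) :
    Summable fun j : ℕ => seriesTerm δ Pi q x (j + (k + 1)) := by
  rcases le_or_gt x 0 with hx | hx
  · simp_rw [← add_assoc, seriesTerm_of_nonpos δ Pi q hx]
    exact summable_zero
  obtain ⟨r, hr, hrδ⟩ := exists_realLaplace_lt hδ hPi hq
  obtain ⟨h0, h1⟩ := realLaplace_div_lt_one hδ hq hrδ
  refine Summable.of_norm_bounded ((summable_mul_geometric h0 h1 (k + 1)).mul_left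
    (Real.exp (r * x) / (x * δ))) fun j => ?_
  exact abs_seriesTerm_le hδ hPi hq hr hx (j + k)

lemma seriesRemainder_of_nonpos {x : ℝ} (hx : x ≤ 0) (k : ℕ) :
    seriesRemainder δ Pi q (k + 1) x = 0 := by
  unfold seriesRemainder
  simp_rw [← add_assoc, seriesTerm_of_nonpos δ Pi q hx]
  exact tsum_zero

lemma seriesRemainder_eq_sum_add (hδ : 0 < δ) (hPi : IsLevyMeasure Pi) (hq : 0 ≤ q) (k : ℕ)
    {N : ℕ} (hN : k + 1 ≤ N) (x : ℝ) :
    seriesRemainder δ Pi q (k + 1) x =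
      ∑ n ∈ Finset.Ico (k + 1) N, seriesTerm δ Pi q x n + seriesRemainder δ Pi q N x := by
  unfold seriesRemainder
  rw [← (summable_seriesTerm hδ hPi hq k x).sum_add_tsum_nat_add (N - (k + 1)),
    Finset.sum_Ico_eq_sum_range]
  congr 1
  · exact Finset.sum_congr rfl fun i _ => by rw [add_comm]
  · congr 1 with j
    congr 1
    omega

/-- `tailAdd Pi q` need not be integrable at infinity; the weight `e^{-y}` repairs this and is
divided out at the end. -/
lemma continuousAt_convPow_tailAdd (hPi : IsLevyMeasure Pi) (hq : 0 ≤ q) (n : ℕ) {x : ℝ}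
    (hx : 0 < x) : ContinuousAt (convPow (tailAdd Pi q) (n + 2)) x := by
  have hφ0 : ∀ y ≤ 0, Real.exp (-(1 * y)) * tailAdd Pi q y = 0 := fun y hy => by
    simp [tailAdd_of_nonpos hy]
  have hc : ∀ᵐ y, ContinuousAt (fun y => Real.exp (-(1 * y)) * tailAdd Pi q y) y := by
    filter_upwards [ae_continuousAt_of_antitoneOn (fun y hy => tailAdd_of_nonpos hy)
      (hPi.antitoneOn_tailAdd q)] with y hy
    exact (by fun_prop : Continuous fun y => Real.exp (-(1 * y))).continuousAt.mul hy
  have h := continuousAt_convPow hφ0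
    (fun y => mul_nonneg (Real.exp_nonneg _) (tailAdd_nonneg Pi hq y))
    (hPi.integrable_exp_mul_tailAdd q one_pos) hc (hPi.mul_exp_mul_tailAdd_le hq one_pos) n hx
  have h2 := (by fun_prop : Continuous fun y => Real.exp (1 * y)).continuousAt.mul h
  refine h2.congr (Eventually.of_forall fun y => ?_)
  change Real.exp (1 * y) * convPow _ (n + 1 + 1) y = _
  rw [convPow_exp_mul, ← mul_assoc, ← Real.exp_add]
  simp

/-- Weierstrass' test on `(x / 2, 2 x)`, where the factor `e^{r y} / (y δ)` of the termwise bound is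
itself bounded. -/
lemma continuousAt_seriesRemainder (hδ : 0 < δ) (hPi : IsLevyMeasure Pi) (hq : 0 ≤ q) (k : ℕ)
    {x : ℝ} (hx : 0 < x) : ContinuousAt (seriesRemainder δ Pi q (k + 2)) x := by
  obtain ⟨r, hr, hrδ⟩ := exists_realLaplace_lt hδ hPi hq
  obtain ⟨h0, h1⟩ := realLaplace_div_lt_one hδ hq hrδ
  have hmem : Ioo (x / 2) (2 * x) ∈ 𝓝 x := Ioo_mem_nhds (by linarith) (by linarith)
  refine ContinuousOn.continuousAt (s := Ioo (x / 2) (2 * x)) ?_ hmem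
  refine continuousOn_tsum (fun j y hy => ?_) ((summable_mul_geometric h0 h1 (k + 2)).mul_left
    (Real.exp (r * (2 * x)) / (x / 2 * δ))) fun j y hy => ?_
  · have hy0 : 0 < y := by linarith [hy.1]
    exact ((continuousAt_convPow_tailAdd hPi hq (j + k) hy0).const_mul
      ((-1) ^ (j + (k + 2)) / δ ^ (j + (k + 2) + 1))).continuousWithinAt
  · have hy0 : 0 < y := by linarith [hy.1]
    refine (abs_seriesTerm_le hδ hPi hq hr hy0 (j + (k + 1))).trans ?_
    have h3 := hy.1.le
    have h4 := hy.2.le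
    refine mul_le_mul_of_nonneg_right ?_ (mul_nonneg (by positivity) (pow_nonneg h0 _))
    gcongr

lemma norm_bilateralLaplace_le (s : ℂ) (hq : 0 ≤ q) :
    ‖bilateralLaplace (tailAdd Pi q) s‖ ≤ realLaplace (tailAdd Pi q) s.re := by
  refine (norm_integral_le_integral_norm _).trans_eq (integral_congr_ae (ae_of_all _ fun x => ?_))
  simp only [norm_mul, norm_exp_neg_mul, Complex.norm_real,
    Real.norm_of_nonneg (tailAdd_nonneg Pi hq x)]

/-- The Laplace transform of the remainder of the series. -/
lemma laplace_seriesRemainder (hδ : 0 < δ) (hPi : IsLevyMeasure Pi) (hq : 0 ≤ q) (k : ℕ) {s : ℂ}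
    (hs : 0 < s.re) (hsδ : realLaplace (tailAdd Pi q) s.re < δ) :
    Integrable (fun x : ℝ => Complex.exp (-(s * x)) * (seriesRemainder δ Pi q (k + 1) x : ℂ)) ∧
      bilateralLaplace (seriesRemainder δ Pi q (k + 1)) s = hFun δ Pi q (k + 1) s := by
  have hf0 : ∀ y ≤ 0, tailAdd Pi q y = 0 := fun y hy => tailAdd_of_nonpos hy
  obtain ⟨h0, h1⟩ := realLaplace_div_lt_one hδ hq hsδ
  set L := bilateralLaplace (tailAdd Pi q) s with hL
  set c := realLaplace (tailAdd Pi q) s.re with hc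
  set F : ℕ → ℝ → ℂ := fun j x =>
    Complex.exp (-(s * x)) * (seriesTerm δ Pi q x (j + (k + 1)) : ℂ) with hF
  have hFe : ∀ j, F j = fun x : ℝ => (((-1) ^ (j + (k + 1)) / δ ^ (j + (k + 1) + 1) : ℝ) : ℂ) *
      (Complex.exp (-(s * x)) * (convPow (tailAdd Pi q) (j + k + 1) x : ℂ)) := fun j => by
    funext x
    simp only [hF, seriesTerm, ← add_assoc]
    push_cast
    ring
  have hpow := fun j : ℕ =>
    bilateralLaplace_convPow hf0 (hPi.laplace_tailAdd q hs).1 (j + k)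
  have hFi : ∀ j, Integrable (F j) := fun j => by
    rw [hFe]
    exact (hpow j).1.const_mul _
  have hFint : ∀ j, ∫ x, F j x = 1 / (δ : ℂ) * (-L / δ) ^ (k + 1) * (-L / δ) ^ j := fun j => by
    rw [hFe, integral_const_mul]
    change _ * bilateralLaplace _ s = _
    rw [(hpow j).2, mul_assoc, ← pow_add, div_pow, neg_pow L, ← hL]
    have : (δ : ℂ) ≠ 0 := by exact_mod_cast hδ.ne'
    have e : j + k + 1 = k + 1 + j := by ring
    have e' : j + (k + 1) = k + 1 + j := by ring
    rw [e, e']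
    push_cast
    field_simp
    ring
  -- The norms integrate to a geometric series of ratio `c / δ < 1`, which permits integration term
  -- by term.
  have hnorm : ∀ j, ∫ x, ‖F j x‖ = 1 / δ * (c / δ) ^ (k + 1) * (c / δ) ^ j := fun j => by
    have hi := (integrable_convPow (φ := fun y => Real.exp (-(s.re * y)) * tailAdd Pi q y)
      (fun y hy => by simp [hf0 y hy]) (hPi.integrable_exp_mul_tailAdd q hs) (j + k)).2
    have e : ∀ x, ‖F j x‖ = (1 / δ ^ (j + k + 2)) *
        convPow (fun y => Real.exp (-(s.re * y)) * tailAdd Pi q y) (j + k + 1) x := fun x => by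
      rw [convPow_exp_mul]
      simp only [hF, norm_mul, norm_exp_neg_mul, Complex.norm_real, Real.norm_eq_abs, ← add_assoc,
        abs_seriesTerm hδ hq]
      ring
    simp_rw [e]
    rw [integral_const_mul, hi]
    change _ * c ^ (j + k + 1) = _
    rw [mul_assoc, ← pow_add, div_pow]
    have e : j + k + 1 = k + 1 + j := by ring
    have e' : j + k + 2 = k + 1 + j + 1 := by ring
    rw [e, e']
    field_simp
    ring
  have hsum : Summable fun j => ∫ x, ‖F j x‖ := by
    simp_rw [hnorm]
    exact (summable_geometric_of_lt_one h0 h1).mul_left _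
  have hpt : ∀ x, Summable fun j => F j x := fun x => by
    refine Summable.mul_left _ ?_
    exact_mod_cast summable_seriesTerm hδ hPi hq k x
  have htsum : ∀ x : ℝ, ∑' j, F j x =
      Complex.exp (-(s * x)) * (seriesRemainder δ Pi q (k + 1) x : ℂ) := fun x => by
    rw [tsum_mul_left, seriesRemainder, Complex.ofReal_tsum]
  have hI := integrable_tsum_of_summable_integral_norm hFi hsum hpt
  have hS := hasSum_integral_of_summable_integral_norm hFi hsum
  simp_rw [htsum] at hI hS
  refine ⟨hI, hS.unique ?_⟩
  have hz : ‖-L / (δ : ℂ)‖ < 1 := by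
    rw [norm_div, norm_neg, Complex.norm_real, Real.norm_of_nonneg hδ.le, div_lt_one hδ]
    exact (norm_bilateralLaplace_le s hq).trans_lt hsδ
  have hg := (hasSum_geometric_of_norm_lt_one hz).mul_left (1 / (δ : ℂ) * (-L / δ) ^ (k + 1))
  simp_rw [hFint]
  suffices hFun δ Pi q (k + 1) s = 1 / (δ : ℂ) * (-L / δ) ^ (k + 1) * (1 - -L / δ)⁻¹ by
    rw [this]
    exact hg
  unfold hFun
  rw [← hL, div_pow, neg_div, sub_neg_eq_add]
  have : (δ : ℂ) ≠ 0 := by exact_mod_cast hδ.ne'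
  rw [show 1 / (δ : ℂ) * L = L / δ by ring, pow_succ (δ : ℂ) (k + 1)]
  simp only [div_eq_mul_inv, mul_inv]
  ring

end

/-! ### Uniqueness of Laplace transforms of measures -/

/-- The star algebra of the bounded functions on `[0, ∞)` that are polynomials in `e^{-x}`. -/
def expPolynomials : StarSubalgebra ℝ (BoundedContinuousFunction ℝ≥0 ℝ) where
  carrier := {g | ∃ p : Polynomial ℝ, ∀ x : ℝ≥0, g x = p.eval (Real.exp (-(x : ℝ)))}
  mul_mem' := by
    rintro f g ⟨p, hp⟩ ⟨p', hp'⟩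
    exact ⟨p * p', fun x => by simp [hp, hp']⟩
  add_mem' := by
    rintro f g ⟨p, hp⟩ ⟨p', hp'⟩
    exact ⟨p + p', fun x => by simp [hp, hp']⟩
  algebraMap_mem' c := ⟨Polynomial.C c, fun x => by simp⟩
  star_mem' := by
    rintro f ⟨p, hp⟩
    exact ⟨p, fun x => by simp [hp]⟩

/-- A finite measure on `[0, ∞)` is determined by its Laplace transform at the natural numbers. -/
lemma ext_of_integral_exp_neg_nat {μ ν : Measure ℝ≥0} [IsFiniteMeasure μ] [IsFiniteMeasure ν]
    (h : ∀ n : ℕ, ∫ x : ℝ≥0, Real.exp (-(x : ℝ)) ^ n ∂μ = ∫ x : ℝ≥0, Real.exp (-(x : ℝ)) ^ n ∂ν) :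
    μ = ν := by
  have hint : ∀ (κ : Measure ℝ≥0) [IsFiniteMeasure κ] (n : ℕ),
      Integrable (fun x : ℝ≥0 => Real.exp (-(x : ℝ)) ^ n) κ := fun κ _ n => by
    refine (integrable_const (1 : ℝ)).mono' (by fun_prop) (ae_of_all _ fun x => ?_)
    rw [norm_pow, Real.norm_of_nonneg (Real.exp_nonneg _)]
    exact pow_le_one₀ (Real.exp_nonneg _) (by simp)
  -- A star subalgebra that separates points determines a finite measure on a Polish space; here
  -- `e^{-x}` alone separates points.
  refine ext_of_forall_mem_subalgebra_integral_eq_of_polish (A := expPolynomials) ?_ ?_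
  · intro x y hxy
    let e : BoundedContinuousFunction ℝ≥0 ℝ := BoundedContinuousFunction.ofNormedAddCommGroup
      (fun x : ℝ≥0 => Real.exp (-(x : ℝ))) (by fun_prop) 1 fun x => by simp
    refine ⟨e, ⟨e.toContinuousMap, ⟨e, ⟨Polynomial.X, fun x => by simp [e]⟩, rfl⟩, rfl⟩, ?_⟩
    intro h
    have h' : Real.exp (-(x : ℝ)) = Real.exp (-(y : ℝ)) := h
    exact hxy (by simpa using h')
  · rintro g ⟨p, hp⟩
    simp_rw [hp, Polynomial.eval_eq_sum_range]
    rw [integral_finsetSum _ fun i _ => (hint μ i).const_mul _,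
      integral_finsetSum _ fun i _ => (hint ν i).const_mul _]
    simp_rw [integral_const_mul, h]

/-- A measure on `[0, ∞)` is determined by its Laplace transform near infinity. -/
lemma ext_of_lintegral_exp_neg {μ ν : Measure ℝ} (hμ : ∀ᵐ x ∂μ, 0 ≤ x) (hν : ∀ᵐ x ∂ν, 0 ≤ x)
    {r : ℝ} (hfin : ∫⁻ x, ENNReal.ofReal (Real.exp (-(r * x))) ∂μ < ∞)
    (h : ∀ r', r ≤ r' → ∫⁻ x, ENNReal.ofReal (Real.exp (-(r' * x))) ∂μ =
      ∫⁻ x, ENNReal.ofReal (Real.exp (-(r' * x))) ∂ν) : μ = ν := by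
  -- Tilting by `e^{-r x}` makes both measures finite; moment `n` of a tilted measure is the
  -- original transform at `r + n`. The tilt and the passage through `ℝ≥0` are undone by `hrec` and
  -- `hback`.
  set w : ℝ → ℝ≥0∞ := fun x => ENNReal.ofReal (Real.exp (-(r * x))) with hw
  have hwm : Measurable w := by fun_prop
  have hrec : ∀ κ : Measure ℝ, (κ.withDensity w).withDensity
      (fun x => ENNReal.ofReal (Real.exp (r * x))) = κ := fun κ => by
    rw [← withDensity_mul _ hwm (by fun_prop)]
    have : w * (fun x => ENNReal.ofReal (Real.exp (r * x))) = 1 := by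
      funext x
      simp only [hw, Pi.mul_apply, Pi.one_apply]
      rw [← ENNReal.ofReal_mul (Real.exp_nonneg _), ← Real.exp_add]
      simp
    rw [this, withDensity_one]
  have hback : ∀ κ : Measure ℝ, (∀ᵐ x ∂κ, 0 ≤ x) →
      ((κ.withDensity w).map Real.toNNReal).map ((↑) : ℝ≥0 → ℝ) = κ.withDensity w := fun κ hκ => by
    rw [Measure.map_map (by fun_prop) (by fun_prop)]
    have : (((↑) : ℝ≥0 → ℝ) ∘ Real.toNNReal) =ᵐ[κ.withDensity w] id := by
      filter_upwards [withDensity_absolutelyContinuous κ w hκ] with x hx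
      exact Real.coe_toNNReal x hx
    rw [Measure.map_congr this, Measure.map_id]
  have hmom : ∀ κ : Measure ℝ, (∀ᵐ x ∂κ, 0 ≤ x) → ∀ n : ℕ,
      ∫ x : ℝ≥0, Real.exp (-(x : ℝ)) ^ n ∂((κ.withDensity w).map Real.toNNReal) =
        (∫⁻ x, ENNReal.ofReal (Real.exp (-((r + n) * x))) ∂κ).toReal := fun κ hκ n => by
    rw [integral_map (by fun_prop) (by fun_prop), integral_eq_lintegral_of_nonneg_ae
      (ae_of_all _ fun x => by positivity) (by fun_prop),
      lintegral_withDensity_eq_lintegral_mul _ hwm (by fun_prop)]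
    congr 1
    refine lintegral_congr_ae ?_
    filter_upwards [hκ] with x hx
    simp only [hw, Pi.mul_apply]
    rw [← ENNReal.ofReal_mul (Real.exp_nonneg _), Real.coe_toNNReal x hx, ← Real.exp_nat_mul,
      ← Real.exp_add]
    congr 2
    ring
  have hf1 : IsFiniteMeasure (μ.withDensity w) := isFiniteMeasure_withDensity hfin.ne
  have hf2 : IsFiniteMeasure (ν.withDensity w) :=
    isFiniteMeasure_withDensity (by rw [← h r le_rfl]; exact hfin.ne)
  have hext : (μ.withDensity w).map Real.toNNReal = (ν.withDensity w).map Real.toNNReal := by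
    refine ext_of_integral_exp_neg_nat fun n => ?_
    rw [hmom μ hμ, hmom ν hν, h _ (by simp)]
  rw [← hrec μ, ← hrec ν, ← hback μ hμ, ← hback ν hν, hext]

/-! ### Laplace transform of the potential measure -/

section

variable {Ω : Type*} [MeasurableSpace Ω] {P : Measure Ω} {X : ℝ≥0 → Ω → ℝ} {δ : ℝ}
  {Pi : Measure ℝ} {q : ℝ}

/-- An almost surely right-continuous process is jointly measurable up to a null set. -/
lemma IsSubordinator.aemeasurable [IsProbabilityMeasure P] (hX : IsSubordinator P X) :
    AEMeasurable (fun z : Ω × ℝ => X z.2.toNNReal z.1)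
      (P.prod (volume.restrict (Ici (0 : ℝ)))) := by
  -- Discretised times approaching `t` from the right. Each takes countably many values, so the
  -- sampled process is jointly measurable; almost sure right-continuity gives the limit.
  set d : ℕ → ℝ≥0 → ℝ≥0 := fun n t => ((⌊((n : ℝ≥0) + 1) * t⌋₊ : ℝ≥0) + 1) / ((n : ℝ≥0) + 1)
    with hd
  have hd1 : ∀ n t, t ≤ d n t := fun n t => by
    rw [hd, le_div_iff₀ (by positivity), mul_comm]
    exact (Nat.lt_floor_add_one _).le
  have hd2 : ∀ n t, d n t ≤ t + 1 / ((n : ℝ≥0) + 1) := fun n t => by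
    have h := Nat.floor_le (a := ((n : ℝ≥0) + 1) * t) (by positivity)
    have e : (t + 1 / ((n : ℝ≥0) + 1)) * ((n : ℝ≥0) + 1) = ((n : ℝ≥0) + 1) * t + 1 := by
      field_simp
    rw [hd, div_le_iff₀ (by positivity), e]
    gcongr
  have hlim : ∀ t, Tendsto (fun n => d n t) atTop (𝓝[≥] t) := fun t => by
    refine tendsto_nhdsWithin_iff.2 ⟨?_, Eventually.of_forall fun n => hd1 n t⟩
    refine tendsto_of_tendsto_of_tendsto_of_le_of_le tendsto_const_nhds ?_ (fun n => hd1 n t)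
      fun n => hd2 n t
    simpa using tendsto_const_nhds.add (tendsto_one_div_add_atTop_nhds_zero_nat (𝕜 := ℝ≥0))
  refine aemeasurable_of_tendsto_metrizable_ae atTop
    (f := fun n (z : Ω × ℝ) => X (d n z.2.toNNReal) z.1) (fun n => ?_) ?_
  · have h1 : Measurable fun p : Ω × ℕ => X (((p.2 : ℝ≥0) + 1) / ((n : ℝ≥0) + 1)) p.1 :=
      measurable_from_prod_countable_left fun k =>
        hX.measurable (((k : ℝ≥0) + 1) / ((n : ℝ≥0) + 1))
    have h2 : Measurable fun z : Ω × ℝ => (z.1, ⌊((n : ℝ≥0) + 1) * z.2.toNNReal⌋₊) :=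
      measurable_fst.prodMk (Nat.measurable_floor.comp (by fun_prop))
    exact (h1.comp h2).aemeasurable
  · filter_upwards [Measure.quasiMeasurePreserving_fst.ae hX.right_continuous] with z hz
    exact (hz z.2.toNNReal).tendsto.comp (hlim _)

lemma IsSubordinator.aemeasurable_withDensity [IsProbabilityMeasure P] (hX : IsSubordinator P X) (w : Ω × ℝ → ℝ≥0∞) :
    AEMeasurable (fun z : Ω × ℝ => X z.2.toNNReal z.1)
      ((P.prod (volume.restrict (Ici (0 : ℝ)))).withDensity w) :=
  hX.aemeasurable.mono_ac (withDensity_absolutelyContinuous _ _)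

lemma IsSubordinator.ae_nonneg [IsProbabilityMeasure P] (hX : IsSubordinator P X) (q : ℝ) :
    ∀ᵐ x ∂(potentialMeasure P X q), 0 ≤ x := by
  unfold potentialMeasure
  rw [ae_map_iff (hX.aemeasurable_withDensity _) measurableSet_Ici]
  refine withDensity_absolutelyContinuous _ _ ?_
  filter_upwards [Measure.quasiMeasurePreserving_fst.ae hX.start_zero,
    Measure.quasiMeasurePreserving_fst.ae hX.nondecreasing] with z h0 hm
  rw [← h0]
  exact hm zero_le

lemma IsSubordinatorWith.lintegral_exp (hX : IsSubordinatorWith P X δ Pi) (t : ℝ≥0) {r : ℝ}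
    (hr : 0 ≤ r) : ∫⁻ ω, ENNReal.ofReal (Real.exp (-(r * X t ω))) ∂P =
      ENNReal.ofReal (Real.exp (-((t : ℝ) * laplaceExponent δ Pi r))) := by
  have h := hX.laplace t r hr
  have hi : Integrable (fun ω => Real.exp (-(r * X t ω))) P := by
    -- Integrability is implied by the formula itself: the integral of a non-integrable function is
    -- `0` by convention, but the right side is positive.
    by_contra hni
    rw [integral_undef hni] at h
    exact (Real.exp_pos _).ne h
  rw [← h, ofReal_integral_eq_lintegral_ofReal hi (ae_of_all _ fun _ => Real.exp_nonneg _)]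

lemma lintegral_exp_neg_mul_Ici {a : ℝ} (ha : 0 < a) :
    ∫⁻ t in Ici (0 : ℝ), ENNReal.ofReal (Real.exp (-(a * t))) = ENNReal.ofReal (1 / a) := by
  have hi := integrableOn_exp_mul_Ioi (neg_lt_zero.2 ha) 0
  have h := integral_exp_mul_Ioi (neg_lt_zero.2 ha) 0
  simp only [neg_mul] at hi h
  rw [setLIntegral_congr Ioi_ae_eq_Ici.symm,
    ← ofReal_integral_eq_lintegral_ofReal hi (ae_of_all _ fun _ => Real.exp_nonneg _), h]
  simp

/-- The Laplace transform of the potential measure. -/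
lemma IsSubordinatorWith.lintegral_exp_potentialMeasure [IsProbabilityMeasure P]
    (hX : IsSubordinatorWith P X δ Pi)
    {r : ℝ} (hr : 0 ≤ r) (hpos : 0 < q + laplaceExponent δ Pi r) :
    ∫⁻ x, ENNReal.ofReal (Real.exp (-(r * x))) ∂(potentialMeasure P X q) =
      ENNReal.ofReal (1 / (q + laplaceExponent δ Pi r)) := by
  have hm : AEMeasurable (fun z : Ω × ℝ => ENNReal.ofReal (Real.exp (-(r * X z.2.toNNReal z.1))))
      (P.prod (volume.restrict (Ici (0 : ℝ)))) :=
    (by fun_prop : Measurable fun x : ℝ => ENNReal.ofReal (Real.exp (-(r * x)))).comp_aemeasurable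
      hX.isSubordinator.aemeasurable
  unfold potentialMeasure
  rw [lintegral_map' (by fun_prop) (hX.isSubordinator.aemeasurable_withDensity _),
    lintegral_withDensity_eq_lintegral_mul₀ (by fun_prop) hm,
    lintegral_prod_symm _ (AEMeasurable.mul (by fun_prop) hm), ← lintegral_exp_neg_mul_Ici hpos]
  refine setLIntegral_congr_fun measurableSet_Ici fun t ht => ?_
  simp only [_root_.Pi.mul_apply]
  rw [lintegral_const_mul' _ _ ENNReal.ofReal_ne_top, hX.lintegral_exp _ hr,
    ← ENNReal.ofReal_mul (Real.exp_nonneg _), ← Real.exp_add, Real.coe_toNNReal t ht]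
  congr 2
  ring

/-- The transform of the tail at a real point, rearranged to expose the geometric series in `1 / (q
+ ψ)`. -/
lemma IsLevyMeasure.add_laplaceExponent (hPi : IsLevyMeasure Pi) (δ q : ℝ) {r : ℝ} (hr : 0 < r) :
    q + laplaceExponent δ Pi r = r * (δ + realLaplace (tailAdd Pi q) r) := by
  have h := (hPi.laplace_tailAdd q (s := (r : ℂ)) hr).2
  rw [bilateralLaplace_ofReal] at h
  have e : ∀ x : ℝ, (1 : ℂ) - Complex.exp (-((r : ℂ) * x)) =
      ((1 - Real.exp (-(r * x)) : ℝ) : ℂ) := fun x => by push_cast; rfl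
  simp_rw [e] at h
  rw [integral_complex_ofReal] at h
  have h' : r * realLaplace (tailAdd Pi q) r = (∫ x, (1 - Real.exp (-(r * x))) ∂Pi) + q := by
    exact_mod_cast h
  unfold laplaceExponent
  rw [Measure.restrict_eq_self_of_ae_mem (s := Ioi 0) hPi.ae_pos, mul_add, h']
  ring

end

/-! ### The primitive of the series is the density; its one-sided derivatives -/

lemma isLevyMeasure_zero : IsLevyMeasure 0 := ⟨by simp, by simp⟩

/-- With zero Lévy measure and `q = 1` the tail function is the Heaviside function. Convolution with
it is integration from `0`, and the lemmas on tails give its transform `1 / r`. -/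
lemma tailAdd_zero_one_of_pos {x : ℝ} (hx : 0 < x) : tailAdd 0 1 x = 1 := by
  simp [tailAdd, tail, hx]

lemma conv_tailAdd_zero_one (g : ℝ → ℝ) {x : ℝ} (hx : 0 < x) :
    conv (tailAdd 0 1) g x = ∫ y in (0 : ℝ)..x, g y := by
  unfold conv
  refine intervalIntegral.integral_congr_ae ?_
  filter_upwards [compl_mem_ae_iff.2 (measure_singleton x)] with y hy hyx
  rw [uIoc_of_le hx.le] at hyx
  rw [tailAdd_zero_one_of_pos (sub_pos.2 (lt_of_le_of_ne hyx.2 hy)), one_mul]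

/-- The continuous potential density: the primitive of the full series with value `1 / δ` at `0+`,
extended by zero to the left; `tailAdd 0 1` is the indicator function of `(0, ∞)`. -/
noncomputable def seriesDensity (δ : ℝ) (Pi : Measure ℝ) (q x : ℝ) : ℝ :=
  1 / δ * tailAdd 0 1 x + conv (tailAdd 0 1) (seriesRemainder δ Pi q 1) x

section

variable {δ : ℝ} {Pi : Measure ℝ} {q : ℝ}

lemma seriesDensity_of_pos {x : ℝ} (hx : 0 < x) :
    seriesDensity δ Pi q x = 1 / δ + ∫ y in (0 : ℝ)..x, seriesRemainder δ Pi q 1 y := by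
  rw [seriesDensity, conv_tailAdd_zero_one _ hx, tailAdd_zero_one_of_pos hx, mul_one]

lemma seriesDensity_of_nonpos {x : ℝ} (hx : x ≤ 0) : seriesDensity δ Pi q x = 0 := by
  rw [seriesDensity, tailAdd_of_nonpos hx, conv_of_nonpos (fun y hy => tailAdd_of_nonpos hy)
    (fun y hy => seriesRemainder_of_nonpos hy 0) hx]
  simp

/-- The Laplace transform of the primitive of the series. -/
lemma laplace_seriesDensity (hδ : 0 < δ) (hPi : IsLevyMeasure Pi) (hq : 0 ≤ q) {r : ℝ}
    (hr : 0 < r) (hrδ : realLaplace (tailAdd Pi q) r < δ) :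
    Integrable (fun x => Real.exp (-(r * x)) * seriesDensity δ Pi q x) ∧
      realLaplace (seriesDensity δ Pi q) r = 1 / (r * (δ + realLaplace (tailAdd Pi q) r)) := by
  obtain ⟨h1, h2⟩ := isLevyMeasure_zero.laplace_tailAdd 1 (s := (r : ℂ)) hr
  obtain ⟨h3, h4⟩ := laplace_seriesRemainder hδ hPi hq 0 (s := (r : ℂ)) hr hrδ
  obtain ⟨h5, h6⟩ := bilateralLaplace_conv (fun y hy => tailAdd_of_nonpos hy)
    (fun y hy => seriesRemainder_of_nonpos hy 0) h1 h3
  have hc := realLaplace_tailAdd_nonneg Pi hq r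
  rw [h4] at h6
  unfold hFun at h6
  simp only [bilateralLaplace_ofReal] at h2 h6
  set c := realLaplace (tailAdd Pi q) r
  have h2' : realLaplace (tailAdd 0 1) r = 1 / r := by
    rw [eq_div_iff hr.ne', mul_comm]
    rw [integral_zero_measure, zero_add] at h2
    exact_mod_cast h2
  have h6' : realLaplace (conv (tailAdd 0 1) (seriesRemainder δ Pi q 1)) r =
      1 / r * ((-c) ^ 1 / (δ ^ 2 * (1 + 1 / δ * c))) := by
    rw [← h2']
    exact_mod_cast h6
  have i1 := integrable_exp_mul_of_complex h1
  have i5 := integrable_exp_mul_of_complex h5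
  have e : ∀ x, Real.exp (-(r * x)) * seriesDensity δ Pi q x =
      1 / δ * (Real.exp (-(r * x)) * tailAdd 0 1 x) +
        Real.exp (-(r * x)) * conv (tailAdd 0 1) (seriesRemainder δ Pi q 1) x := fun x => by
    unfold seriesDensity
    ring
  refine ⟨((i1.const_mul _).add i5).congr (ae_of_all _ fun x => (e x).symm), ?_⟩
  rw [realLaplace]
  simp_rw [e]
  rw [integral_add (i1.const_mul _) i5, integral_const_mul]
  change 1 / δ * realLaplace _ r + realLaplace _ r = _
  rw [h2', h6']
  field_simp
  ring

lemma intervalIntegrable_seriesRemainder (hδ : 0 < δ) (hPi : IsLevyMeasure Pi) (hq : 0 ≤ q)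
    (k : ℕ) (a b : ℝ) : IntervalIntegrable (seriesRemainder δ Pi q (k + 1)) volume a b := by
  obtain ⟨r, hr, hrδ⟩ := exists_realLaplace_lt hδ hPi hq
  have h := integrable_exp_mul_of_complex
    (laplace_seriesRemainder hδ hPi hq k (s := (r : ℂ)) hr hrδ).1
  have h2 := (h.intervalIntegrable (a := a) (b := b)).continuousOn_mul
    (by fun_prop : ContinuousOn (fun x => Real.exp (r * x)) (uIcc a b))
  refine h2.congr fun x _ => ?_
  rw [← mul_assoc, ← Real.exp_add]
  simp

lemma continuousOn_seriesDensity (hδ : 0 < δ) (hPi : IsLevyMeasure Pi) (hq : 0 ≤ q) :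
    ContinuousOn (seriesDensity δ Pi q) (Ioi 0) := by
  have h : Continuous fun x => 1 / δ + ∫ y in (0 : ℝ)..x, seriesRemainder δ Pi q 1 y :=
    continuous_const.add (intervalIntegral.continuous_primitive
      (intervalIntegrable_seriesRemainder hδ hPi hq 0) 0)
  exact h.continuousOn.congr fun x hx => seriesDensity_of_pos hx

lemma seriesRemainder_one_eq (hδ : 0 < δ) (hPi : IsLevyMeasure Pi) (hq : 0 ≤ q) {x : ℝ}
    (hx : 0 < x) :
    seriesRemainder δ Pi q 1 x = -(tail Pi x + q) / δ ^ 2 + seriesRemainder δ Pi q 2 x := by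
  rw [seriesRemainder_eq_sum_add hδ hPi hq 0 (N := 2) (by norm_num) x]
  simp [seriesTerm, convPow, tailAdd_of_pos hx]
  ring

/-- Only the term `n = 1` can jump; the remainder from `2` on is continuous at `x`. -/
lemma tendsto_seriesRemainder_one (hδ : 0 < δ) (hPi : IsLevyMeasure Pi) (hq : 0 ≤ q) {x : ℝ}
    (hx : 0 < x) {l : Filter ℝ} (hl : l ≤ 𝓝 x) {c : ℝ} (hc : Tendsto (tail Pi) l (𝓝 c)) :
    Tendsto (seriesRemainder δ Pi q 1) l
      (𝓝 (-(c + q) / δ ^ 2 + seriesRemainder δ Pi q 2 x)) := by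
  have h := (((hc.add_const q).neg).div_const (δ ^ 2)).add
    ((continuousAt_seriesRemainder hδ hPi hq 0 hx).tendsto.mono_left hl)
  refine h.congr' ?_
  filter_upwards [hl (Ioi_mem_nhds hx)] with y hy
  exact (seriesRemainder_one_eq hδ hPi hq hy).symm

lemma stronglyMeasurableAtFilter_seriesRemainder (hδ : 0 < δ) (hPi : IsLevyMeasure Pi)
    (hq : 0 ≤ q) (x : ℝ) (l : Filter ℝ) (hl : l ≤ 𝓝 x) :
    StronglyMeasurableAtFilter (seriesRemainder δ Pi q 1) l := by
  refine ⟨Ioc (x - 1) (x + 1), hl (Ioc_mem_nhds (by linarith) (by linarith)), ?_⟩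
  exact (intervalIntegrable_seriesRemainder hδ hPi hq 0 (x - 1) (x + 1)).1.aestronglyMeasurable

/-- The one-sided derivatives of the primitive of the series. -/
lemma hasDerivWithinAt_seriesDensity (hδ : 0 < δ) (hPi : IsLevyMeasure Pi) (hq : 0 ≤ q) {x : ℝ}
    (hx : 0 < x) :
    HasDerivWithinAt (seriesDensity δ Pi q)
      (-(Function.rightLim (tail Pi) x + q) / δ ^ 2 + seriesRemainder δ Pi q 2 x) (Ioi x) x ∧
    HasDerivWithinAt (seriesDensity δ Pi q)
      (-(Function.leftLim (tail Pi) x + q) / δ ^ 2 + seriesRemainder δ Pi q 2 x) (Iio x) x := by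
  have hint := intervalIntegrable_seriesRemainder hδ hPi hq 0 0 x
  have heq : seriesDensity δ Pi q =ᶠ[𝓝 x]
      fun x => 1 / δ + ∫ y in (0 : ℝ)..x, seriesRemainder δ Pi q 1 y := by
    filter_upwards [Ioi_mem_nhds hx] with y hy
    exact seriesDensity_of_pos hy
  constructor
  · have hlim := tendsto_seriesRemainder_one hδ hPi hq hx nhdsWithin_le_nhds
      (tendsto_rightLim_of_antitoneOn hPi.antitoneOn_tail hx)
    have h := intervalIntegral.integral_hasDerivWithinAt_of_tendsto_ae_right (s := Ici x)
      (t := Ioi x) hint (stronglyMeasurableAtFilter_seriesRemainder hδ hPi hq x _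
        nhdsWithin_le_nhds) (hlim.mono_left inf_le_left)
    exact ((h.mono Ioi_subset_Ici_self).const_add (1 / δ)).congr_of_eventuallyEq
      (heq.filter_mono nhdsWithin_le_nhds) heq.eq_of_nhds
  · have hlim := tendsto_seriesRemainder_one hδ hPi hq hx nhdsWithin_le_nhds
      (tendsto_leftLim_of_antitoneOn hPi.antitoneOn_tail hx)
    -- On the left the calculus lemma asks for the limit along `Iic x` up to null sets; the point
    -- `x` is null, so the limit along `Iio x` suffices.
    have hlim' : Tendsto (seriesRemainder δ Pi q 1) (𝓝[Iic x] x ⊓ ae volume)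
        (𝓝 (-(Function.leftLim (tail Pi) x + q) / δ ^ 2 + seriesRemainder δ Pi q 2 x)) := by
      refine hlim.mono_left ?_
      have : ({x}ᶜ : Set ℝ) ∈ ae volume := compl_mem_ae_iff.2 (measure_singleton x)
      rw [nhdsWithin, nhdsWithin, inf_assoc]
      refine le_inf inf_le_left (le_principal_iff.2 ?_)
      filter_upwards [mem_inf_of_right (mem_inf_of_left (mem_principal_self (Iic x))),
        mem_inf_of_right (mem_inf_of_right this)] with y hy1 hy2
      exact lt_of_le_of_ne hy1 hy2
    have h := intervalIntegral.integral_hasDerivWithinAt_of_tendsto_ae_right (s := Iic x)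
      (t := Iic x) hint (stronglyMeasurableAtFilter_seriesRemainder hδ hPi hq x _
        nhdsWithin_le_nhds) hlim'
    exact ((h.mono Iio_subset_Iic_self).const_add (1 / δ)).congr_of_eventuallyEq
      (heq.filter_mono nhdsWithin_le_nhds) heq.eq_of_nhds

variable {Ω : Type*} [MeasurableSpace Ω] {P : Measure Ω} {X : ℝ≥0 → Ω → ℝ}

/-- The primitive of the series is the density of the potential measure. -/
lemma isPotentialDensity_seriesDensity [IsProbabilityMeasure P] (hδ : 0 < δ)
    (hX : IsSubordinatorWith P X δ Pi) (hq : 0 ≤ q) :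
    IsPotentialDensity P X q (seriesDensity δ Pi q) := by
  have hPi := hX.isLevyMeasure
  obtain ⟨r₀, hr₀, hrδ₀⟩ := exists_realLaplace_lt hδ hPi hq
  set u := seriesDensity δ Pi q with hu
  have huc : ContinuousOn u (Ioi 0) := continuousOn_seriesDensity hδ hPi hq
  have hum : AEMeasurable u (volume.restrict (Ioi 0)) := huc.aemeasurable measurableSet_Ioi
  have hum' : AEMeasurable (fun x => -u x) (volume.restrict (Ioi 0)) := hum.neg
  set V : Measure ℝ := volume.restrict (Ioi 0)
  -- The sign of `u` is not yet known, so its negative part is added to the potential measure and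
  -- its positive part forms `ν`; Laplace transforms then compare positive measures.
  set μ := potentialMeasure P X q + V.withDensity fun x => ENNReal.ofReal (-u x) with hμ
  set ν := V.withDensity fun x => ENNReal.ofReal (u x) with hν
  have hV : ∀ᵐ x ∂V, 0 ≤ x :=
    (ae_restrict_mem measurableSet_Ioi).mono fun x hx => le_of_lt hx
  have hwd : ∀ (g : ℝ → ℝ) (r : ℝ), AEMeasurable g V →
      ∫⁻ x, ENNReal.ofReal (Real.exp (-(r * x))) ∂V.withDensity (fun x => ENNReal.ofReal (g x)) =
        ∫⁻ x, ENNReal.ofReal (Real.exp (-(r * x)) * g x) ∂V := fun g r hg => by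
    rw [lintegral_withDensity_eq_lintegral_mul₀ (by fun_prop) (by fun_prop)]
    refine lintegral_congr fun x => ?_
    rw [_root_.Pi.mul_apply, mul_comm, ENNReal.ofReal_mul (Real.exp_nonneg _)]
  have hlap : ∀ r, r₀ ≤ r → ∫⁻ x, ENNReal.ofReal (Real.exp (-(r * x))) ∂μ =
      ∫⁻ x, ENNReal.ofReal (Real.exp (-(r * x))) ∂ν ∧
      ∫⁻ x, ENNReal.ofReal (Real.exp (-(r * x))) ∂ν < ∞ := fun r hr => by
    have hr0 : 0 < r := hr₀.trans_le hr
    have hrδ : realLaplace (tailAdd Pi q) r < δ :=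
      (hPi.realLaplace_tailAdd_antitoneOn hq hr₀ hr0 hr).trans_lt hrδ₀
    obtain ⟨hi, hL⟩ := laplace_seriesDensity hδ hPi hq hr0 hrδ
    have hc := realLaplace_tailAdd_nonneg Pi hq r
    have hpos : 0 < r * (δ + realLaplace (tailAdd Pi q) r) := by positivity
    have hU := hX.lintegral_exp_potentialMeasure (q := q) hr0.le
      (by rw [hPi.add_laplaceExponent δ q hr0]; exact hpos)
    rw [hPi.add_laplaceExponent δ q hr0, ← hL] at hU
    have hL0 : 0 ≤ realLaplace u r := by rw [hL]; positivity
    have hiV : Integrable (fun x => Real.exp (-(r * x)) * u x) V := hi.integrableOn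
    have hLV : realLaplace u r = ∫ x, Real.exp (-(r * x)) * u x ∂V := by
      refine (setIntegral_eq_integral_of_forall_compl_eq_zero fun x hx => ?_).symm
      rw [hu, seriesDensity_of_nonpos (by simpa using hx), mul_zero]
    have hpn := integral_eq_lintegral_pos_part_sub_lintegral_neg_part hiV
    rw [← hLV] at hpn
    have hfp : ∫⁻ x, ENNReal.ofReal (Real.exp (-(r * x)) * u x) ∂V ≠ ∞ :=
      hiV.lintegral_lt_top.ne
    have hfn : ∫⁻ x, ENNReal.ofReal (-(Real.exp (-(r * x)) * u x)) ∂V ≠ ∞ :=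
      hiV.neg.lintegral_lt_top.ne
    rw [hμ, lintegral_add_measure, hU, hwd _ _ hum', hwd _ _ hum]
    refine ⟨?_, hfp.lt_top⟩
    simp_rw [mul_neg]
    rw [← ENNReal.toReal_eq_toReal_iff' (ENNReal.add_ne_top.2 ⟨ENNReal.ofReal_ne_top, hfn⟩) hfp,
      ENNReal.toReal_add ENNReal.ofReal_ne_top hfn, ENNReal.toReal_ofReal hL0, hpn]
    ring
  have hμν : μ = ν := by
    refine ext_of_lintegral_exp_neg (r := r₀) ?_ (withDensity_absolutelyContinuous _ _ hV) ?_
      fun r hr => (hlap r hr).1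
    · rw [hμ, ae_add_measure_iff]
      exact ⟨hX.isSubordinator.ae_nonneg q, withDensity_absolutelyContinuous _ _ hV⟩
    · rw [(hlap r₀ le_rfl).1]
      exact (hlap r₀ le_rfl).2
  -- From `μ = ν` the negative part of `u` is dominated by the positive part. This forces `u ≥ 0`
  -- almost everywhere, and everywhere on `(0, ∞)` by continuity.
  have hle : V.withDensity (fun x => ENNReal.ofReal (-u x)) ≤ ν := by
    rw [← hμν, hμ]
    exact Measure.le_add_left le_rfl
  have hae : (fun x => ENNReal.ofReal (-u x)) ≤ᵐ[V] fun x => ENNReal.ofReal (u x) := by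
    refine ae_le_of_forall_setLIntegral_le_of_sigmaFinite₀ hum'.ennreal_ofReal
      fun s hs _ => ?_
    rw [← withDensity_apply _ hs, ← withDensity_apply _ hs]
    exact hle s
  have hnn : ∀ᵐ x ∂V, 0 ≤ u x := by
    filter_upwards [hae] with x hx
    by_contra h
    push Not at h
    rw [ENNReal.ofReal_of_nonpos h.le] at hx
    have := ENNReal.ofReal_eq_zero.1 (le_antisymm hx bot_le)
    linarith
  have hnn' : ∀ x, 0 < x → 0 ≤ u x := by
    have h1 : u =ᵐ[V] fun x => max (u x) 0 := hnn.mono fun x hx => (max_eq_left hx).symm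
    have h2 := Measure.eqOn_open_of_ae_eq h1 isOpen_Ioi huc (huc.sup continuousOn_const)
    intro x hx
    rw [h2 hx]
    exact le_max_right _ _
  refine ⟨hnn', huc, ?_⟩
  rw [← hν, ← hμν, hμ]
  have : V.withDensity (fun x => ENNReal.ofReal (-u x)) = 0 := by
    rw [withDensity_eq_zero_iff hum'.ennreal_ofReal]
    filter_upwards [hnn] with x hx
    simpa using hx
  rw [this, add_zero]

lemma IsPotentialDensity.eqOn {u v : ℝ → ℝ} (hu : IsPotentialDensity P X q u)
    (hv : IsPotentialDensity P X q v) : EqOn u v (Ioi 0) := by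
  refine Measure.eqOn_open_of_ae_eq (μ := volume) ?_ isOpen_Ioi hu.continuousOn hv.continuousOn
  have h := hu.density.symm.trans hv.density
  rw [withDensity_eq_iff_of_sigmaFinite
    (hu.continuousOn.aemeasurable measurableSet_Ioi).ennreal_ofReal
    (hv.continuousOn.aemeasurable measurableSet_Ioi).ennreal_ofReal] at h
  filter_upwards [h, ae_restrict_mem measurableSet_Ioi] with x hx hx0
  exact (ENNReal.ofReal_eq_ofReal_iff (hu.nonneg x hx0) (hv.nonneg x hx0)).1 hx

end

/-! ### Analyticity and decay of `h^{N,q}` in the right half-plane -/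

lemma linePoint_re (r θ : ℝ) : (linePoint r θ).re = r := by simp [linePoint]

lemma linePoint_im (r θ : ℝ) : (linePoint r θ).im = θ := by simp [linePoint]

lemma continuous_linePoint (r : ℝ) : Continuous (linePoint r) := by
  unfold linePoint
  fun_prop

section

variable {δ : ℝ} {Pi : Measure ℝ} {q : ℝ}

/-- At a zero, `s L(s) = -δ s` would have negative real part, whereas `s L(s) = ∫ (1 - e^{-s x})
Π(dx) + q` has non-negative real part. -/
lemma one_add_bilateralLaplace_ne_zero (hδ : 0 < δ) (hPi : IsLevyMeasure Pi) (hq : 0 ≤ q) {s : ℂ}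
    (hs : 0 < s.re) : 1 + 1 / (δ : ℂ) * bilateralLaplace (tailAdd Pi q) s ≠ 0 := by
  intro h
  have hδ' : (δ : ℂ) ≠ 0 := by exact_mod_cast hδ.ne'
  have hL : bilateralLaplace (tailAdd Pi q) s = -δ := by
    field_simp at h
    linear_combination h
  have h2 := (hPi.laplace_tailAdd q hs).2
  rw [hL] at h2
  have hre : 0 ≤ (∫ x : ℝ, (1 - Complex.exp (-(s * x))) ∂Pi).re := by
    have := (hPi.integrable_one_sub_exp hs.le)
    rw [← RCLike.re_eq_complex_re, ← integral_re this]
    refine integral_nonneg_of_ae ?_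
    filter_upwards [hPi.ae_pos] with x hx
    have h3 := (Complex.re_le_norm (Complex.exp (-(s * x)))).trans_eq (norm_exp_neg_mul s x)
    have h4 : Real.exp (-(s.re * x)) ≤ 1 := by
      rw [Real.exp_le_one_iff, neg_nonpos]
      positivity
    simp only [_root_.Pi.zero_apply, RCLike.re_eq_complex_re, Complex.sub_re, Complex.one_re]
    linarith
  have h5 := congrArg Complex.re h2
  simp only [Complex.mul_re, Complex.neg_re, Complex.ofReal_re, Complex.neg_im, Complex.ofReal_im,
    Complex.add_re] at h5
  nlinarith

lemma differentiableAt_bilateralLaplace (hPi : IsLevyMeasure Pi) (hq : 0 ≤ q) {s : ℂ}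
    (hs : 0 < s.re) : DifferentiableAt ℂ (bilateralLaplace (tailAdd Pi q)) s := by
  -- Half of `Re s` leaves room around `s`; the factor `x` produced by differentiation is absorbed
  -- by half of the remaining exponential, through `x ≤ (2 / ρ) e^{ρ x / 2}`.
  set ρ := s.re / 2 with hρ
  have hρ0 : 0 < ρ := by positivity
  have hmem : {z : ℂ | ρ < z.re} ∈ 𝓝 s :=
    (isOpen_lt continuous_const Complex.continuous_re).mem_nhds (by simp [hρ, hs])
  have h := hasDerivAt_integral_of_dominated_loc_of_deriv_le (μ := volume) (x₀ := s)
    (F := fun (z : ℂ) (x : ℝ) => Complex.exp (-(z * x)) * (tailAdd Pi q x : ℂ))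
    (F' := fun (z : ℂ) (x : ℝ) => -(x : ℂ) * (Complex.exp (-(z * x)) * (tailAdd Pi q x : ℂ)))
    (bound := fun x => 2 / ρ * (Real.exp (-(ρ / 2 * x)) * tailAdd Pi q x)) hmem ?_
    (hPi.laplace_tailAdd q hs).1 ?_ ?_ ?_ ?_
  · exact h.2.differentiableAt
  · filter_upwards [hmem] with z hz
    exact (hPi.laplace_tailAdd q (hρ0.trans hz)).1.aestronglyMeasurable
  · exact (by fun_prop : Continuous fun x : ℝ => -(x : ℂ)).aestronglyMeasurable.mul
      (hPi.laplace_tailAdd q hs).1.aestronglyMeasurable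
  · refine ae_of_all _ fun x z hz => ?_
    rcases le_or_gt x 0 with hx | hx
    · simp [tailAdd_of_nonpos hx]
    · have h0 := tailAdd_nonneg Pi hq x
      rw [norm_mul, norm_mul, norm_exp_neg_mul, norm_neg, Complex.norm_real, Complex.norm_real,
        Real.norm_of_nonneg hx.le, Real.norm_of_nonneg h0, ← mul_assoc, ← mul_assoc]
      refine mul_le_mul_of_nonneg_right ?_ h0
      have h1 : ρ / 2 * x ≤ Real.exp (ρ / 2 * x) := by
        linarith [Real.add_one_le_exp (ρ / 2 * x)]
      have h2 : Real.exp (-(z.re * x)) ≤ Real.exp (-(ρ * x)) := by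
        gcongr
        exact le_of_lt hz
      calc x * Real.exp (-(z.re * x)) ≤ (2 / ρ * Real.exp (ρ / 2 * x)) * Real.exp (-(ρ * x)) := by
            gcongr
            rw [div_mul_eq_mul_div, le_div_iff₀ hρ0]
            linarith
        _ = 2 / ρ * Real.exp (-(ρ / 2 * x)) := by
            rw [mul_assoc, ← Real.exp_add]
            congr 2
            ring
  · exact (hPi.integrable_exp_mul_tailAdd q (half_pos hρ0)).const_mul _
  · refine ae_of_all _ fun x z _ => ?_
    have h1 : HasDerivAt (fun z : ℂ => -(z * x)) (-(x : ℂ)) z :=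
      (hasDerivAt_mul_const (x : ℂ)).fun_neg
    exact (h1.cexp.mul_const (tailAdd Pi q x : ℂ)).congr_deriv (by ring)

lemma differentiableAt_hFun (hδ : 0 < δ) (hPi : IsLevyMeasure Pi) (hq : 0 ≤ q) (N : ℕ) {s : ℂ}
    (hs : 0 < s.re) : DifferentiableAt ℂ (hFun δ Pi q N) s := by
  have hL := differentiableAt_bilateralLaplace hPi hq hs
  have hδ' : (δ : ℂ) ≠ 0 := by exact_mod_cast hδ.ne'
  unfold hFun
  exact (hL.neg.pow N).div (((hL.const_mul _).const_add _).const_mul _)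
    (mul_ne_zero (pow_ne_zero _ hδ') (one_add_bilateralLaplace_ne_zero hδ hPi hq hs))

lemma continuous_hFun_linePoint (hδ : 0 < δ) (hPi : IsLevyMeasure Pi) (hq : 0 ≤ q) (N : ℕ) {r : ℝ}
    (hr : 0 < r) : Continuous fun θ => hFun δ Pi q N (linePoint r θ) := by
  refine continuous_iff_continuousAt.2 fun θ => ?_
  exact ContinuousAt.comp (g := hFun δ Pi q N)
    (differentiableAt_hFun hδ hPi hq N (by rwa [linePoint_re])).continuousAt
    (continuous_linePoint r).continuousAt

/-- Decay of the Laplace transform of the tail plus `q` at infinity. -/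
lemma exists_norm_bilateralLaplace_le (hPi : IsLevyMeasure Pi) (hq : 0 ≤ q) {γ : ℝ} (hγ0 : 0 < γ)
    (hγ1 : γ < 1)
    (hγ : ∫⁻ x in Ioc (0 : ℝ) 1, ENNReal.ofReal (x ^ γ) ∂Pi < ∞) :
    ∃ C, 0 ≤ C ∧ ∀ s : ℂ, 0 < s.re → 1 ≤ ‖s‖ →
      ‖bilateralLaplace (tailAdd Pi q) s‖ ≤ C * ‖s‖ ^ (γ - 1) := by
  -- Since `min 1 t ≤ t ^ γ`, this `Pi`-integrable function satisfies `min 1 (‖s‖ x) ≤ ‖s‖ ^ γ * m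
  -- x` whenever `‖s‖ ≥ 1`.
  set m : ℝ → ℝ := fun x => (Ioc 0 1).indicator (fun x => x ^ γ) x +
    (Ici 1).indicator (fun _ => (1 : ℝ)) x with hm
  have hi1 : Integrable ((Ioc 0 1).indicator fun x : ℝ => x ^ γ) Pi := by
    rw [integrable_indicator_iff measurableSet_Ioc]
    refine ⟨(by fun_prop : Measurable fun x : ℝ => x ^ γ).aestronglyMeasurable, ?_⟩
    rw [hasFiniteIntegral_iff_ofReal]
    · exact hγ
    · filter_upwards [ae_restrict_mem measurableSet_Ioc] with x hx
      exact Real.rpow_nonneg hx.1.le _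
  have hi2 : Integrable ((Ici 1).indicator fun _ : ℝ => (1 : ℝ)) Pi := by
    rw [integrable_indicator_iff measurableSet_Ici]
    exact integrableOn_const (hPi.measure_Ici_lt_top one_pos).ne
  have hmi : Integrable m Pi := hi1.add hi2
  have hm0 : ∀ x, 0 ≤ m x := fun x => by
    refine add_nonneg (indicator_nonneg (fun y hy => Real.rpow_nonneg hy.1.le _) _)
      (indicator_nonneg (fun _ _ => zero_le_one) _)
  have hM0 : 0 ≤ ∫ x, m x ∂Pi := integral_nonneg hm0
  refine ⟨2 * (∫ x, m x ∂Pi) + q, by positivity, fun s hs h1 => ?_⟩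
  have hs0 : 0 < ‖s‖ := one_pos.trans_le h1
  have hp1 : 1 ≤ ‖s‖ ^ γ := Real.one_le_rpow h1 hγ0.le
  have hb : ‖∫ x : ℝ, (1 - Complex.exp (-(s * x))) ∂Pi‖ ≤ 2 * ‖s‖ ^ γ * ∫ x, m x ∂Pi := by
    rw [← integral_const_mul]
    refine norm_integral_le_of_norm_le (hmi.const_mul _) ?_
    filter_upwards [hPi.ae_pos] with x hx
    refine (norm_one_sub_exp_neg_le ?_).trans ?_
    · simpa using mul_nonneg hs.le hx.le
    rw [norm_mul, Complex.norm_real, Real.norm_of_nonneg hx.le, mul_assoc]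
    gcongr
    rcases le_or_gt x 1 with hx1 | hx1
    · have hm1 : x ^ γ ≤ m x := by
        rw [hm]
        simp only [indicator_of_mem (show x ∈ Ioc 0 1 from ⟨hx, hx1⟩)]
        exact le_add_of_nonneg_right (indicator_nonneg (fun _ _ => zero_le_one) _)
      refine le_trans ?_ (mul_le_mul_of_nonneg_left hm1 (by positivity))
      rw [← Real.mul_rpow hs0.le hx.le]
      have ht : 0 < ‖s‖ * x := by positivity
      rcases le_total (‖s‖ * x) 1 with h | h
      · refine (min_le_right _ _).trans ?_
        simpa using Real.rpow_le_rpow_of_exponent_ge ht h hγ1.le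
      · exact (min_le_left _ _).trans (Real.one_le_rpow h hγ0.le)
    · have hm1 : 1 ≤ m x := by
        rw [hm]
        simp only [indicator_of_mem (show x ∈ Ici 1 from hx1.le)]
        exact le_add_of_nonneg_left
          (indicator_nonneg (fun y hy => Real.rpow_nonneg hy.1.le _) _)
      exact (min_le_left _ _).trans (one_le_mul_of_one_le_of_one_le hp1 hm1)
  have h2 := congrArg norm (hPi.laplace_tailAdd q hs).2
  rw [norm_mul] at h2
  have h3 : ‖s‖ * ‖bilateralLaplace (tailAdd Pi q) s‖ ≤
      (2 * (∫ x, m x ∂Pi) + q) * ‖s‖ ^ γ := by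
    rw [h2]
    refine (norm_add_le _ _).trans ?_
    rw [Complex.norm_real, Real.norm_of_nonneg hq]
    nlinarith
  rw [Real.rpow_sub_one hs0.ne', ← mul_div_assoc, le_div_iff₀ hs0, mul_comm]
  exact h3

/-- The strict inequality leaves room for an admissible `γ` with `γ < 1 - 1 / N`. The exponent `1`
is always admissible, so the infimum is over a nonempty set, and it is non-negative, whence `N > 1`.
-/
lemma exists_index_of_blumenthalGetoor_lt (hPi : IsLevyMeasure Pi) (hβ : blumenthalGetoor Pi < 1)
    {N : ℕ} (hN : 1 / (1 - blumenthalGetoor Pi) < (N : ℝ)) :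
    2 ≤ N ∧ ∃ γ : ℝ, 0 < γ ∧ γ < 1 ∧ 1 < (N : ℝ) * (1 - γ) ∧
      ∫⁻ x in Ioc (0 : ℝ) 1, ENNReal.ofReal (x ^ γ) ∂Pi < ∞ := by
  set S := {γ : ℝ | 0 < γ ∧ ∫⁻ x in Ioc (0 : ℝ) 1, ENNReal.ofReal (x ^ γ) ∂Pi < ∞}
  have hβ0 : 0 ≤ blumenthalGetoor Pi := Real.sInf_nonneg fun γ hγ => hγ.1.le
  have hpos : 0 < 1 - blumenthalGetoor Pi := by linarith
  have hN0 : (0 : ℝ) < N := lt_trans (by positivity) hN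
  have hN1 : 1 < (N : ℝ) * (1 - blumenthalGetoor Pi) := by rwa [div_lt_iff₀ hpos] at hN
  have hS : S.Nonempty := by
    refine ⟨1, one_pos, lt_of_le_of_lt ?_ hPi.integrable_min⟩
    refine (setLIntegral_mono (by fun_prop) fun x hx => ?_).trans
      (setLIntegral_le_lintegral (Ioc 0 1) _)
    rw [Real.rpow_one, min_eq_right hx.2]
  have hlt : sInf S < 1 - 1 / N := by
    have : 1 / (N : ℝ) < 1 - blumenthalGetoor Pi := by
      rw [div_lt_iff₀ hN0]
      linarith
    change blumenthalGetoor Pi < _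
    linarith
  obtain ⟨γ, hγS, hγ⟩ := exists_lt_of_csInf_lt hS hlt
  have hN' : 0 < 1 / (N : ℝ) := by positivity
  refine ⟨?_, γ, hγS.1, by linarith, ?_, hγS.2⟩
  · have : (1 : ℝ) < N := by nlinarith
    exact_mod_cast this
  · have : 1 / (N : ℝ) < 1 - γ := by linarith
    rw [div_lt_iff₀ hN0] at this
    linarith

/-- Decay of `h^{N,q}` at infinity. -/
lemma exists_norm_hFun_le (hδ : 0 < δ) (hPi : IsLevyMeasure Pi) (hq : 0 ≤ q)
    (hβ : blumenthalGetoor Pi < 1) {N : ℕ} (hN : 1 / (1 - blumenthalGetoor Pi) < (N : ℝ)) :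
    ∃ a K T : ℝ, 1 < a ∧ 0 ≤ K ∧ 1 ≤ T ∧ ∀ s : ℂ, 0 < s.re → T ≤ |s.im| →
      ‖hFun δ Pi q N s‖ ≤ K * |s.im| ^ (-a) := by
  obtain ⟨-, γ, hγ0, hγ1, hNγ, hγ⟩ := exists_index_of_blumenthalGetoor_lt hPi hβ hN
  obtain ⟨C, hC0, hC⟩ := exists_norm_bilateralLaplace_le hPi hq hγ0 hγ1 hγ
  have hlim : Tendsto (fun t : ℝ => C * t ^ (γ - 1)) atTop (𝓝 0) := by
    have := (tendsto_rpow_neg_atTop (y := 1 - γ) (by linarith)).const_mul C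
    simpa using this
  -- Beyond `T` the transform is at most `δ / 2` in norm, so the denominator factor stays above `1 /
  -- 2`, uniformly in `Re s > 0` as the contour shift requires.
  obtain ⟨T, hT1, hT⟩ := ((eventually_ge_atTop (1 : ℝ)).and
    (hlim.eventually (gt_mem_nhds (half_pos hδ)))).exists
  refine ⟨N * (1 - γ), C ^ N * (2 / δ ^ (N + 1)), T, hNγ, by positivity, hT1,
    fun s hs hTs => ?_⟩
  have him : |s.im| ≤ ‖s‖ := Complex.abs_im_le_norm s
  have him0 : 0 < |s.im| := by linarith
  have hLs : ‖bilateralLaplace (tailAdd Pi q) s‖ ≤ C * |s.im| ^ (γ - 1) :=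
    (hC s hs (by linarith)).trans (mul_le_mul_of_nonneg_left
      (Real.rpow_le_rpow_of_nonpos him0 him (by linarith)) hC0)
  have hLT : ‖bilateralLaplace (tailAdd Pi q) s‖ ≤ δ / 2 :=
    (hLs.trans (mul_le_mul_of_nonneg_left
      (Real.rpow_le_rpow_of_nonpos (by linarith) hTs (by linarith)) hC0)).trans hT.le
  have hden : 1 / 2 ≤ ‖1 + 1 / (δ : ℂ) * bilateralLaplace (tailAdd Pi q) s‖ := by
    have h1 := norm_sub_le_norm_add (1 : ℂ) (1 / (δ : ℂ) * bilateralLaplace (tailAdd Pi q) s)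
    have h2 : ‖1 / (δ : ℂ) * bilateralLaplace (tailAdd Pi q) s‖ ≤ 1 / 2 := by
      rw [norm_mul, norm_div, norm_one, Complex.norm_real, Real.norm_of_nonneg hδ.le,
        one_div_mul_eq_div, div_le_iff₀ hδ]
      linarith
    rw [norm_one] at h1
    linarith
  unfold hFun
  rw [norm_div, norm_pow, norm_neg, norm_mul, norm_pow, Complex.norm_real,
    Real.norm_of_nonneg hδ.le]
  calc _ ≤ (C * |s.im| ^ (γ - 1)) ^ N / (δ ^ (N + 1) * (1 / 2)) := by gcongr
    _ = _ := by
      rw [mul_pow, ← Real.rpow_mul_natCast him0.le]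
      have : (γ - 1) * (N : ℝ) = -(N * (1 - γ)) := by ring
      rw [this]
      field_simp

lemma integrable_hFun (hδ : 0 < δ) (hPi : IsLevyMeasure Pi) (hq : 0 ≤ q)
    (hβ : blumenthalGetoor Pi < 1) {N : ℕ} (hN : 1 / (1 - blumenthalGetoor Pi) < (N : ℝ)) {r : ℝ}
    (hr : 0 < r) : Integrable fun θ : ℝ => hFun δ Pi q N (linePoint r θ) := by
  obtain ⟨a, K, T, ha, hK, hT, hb⟩ := exists_norm_hFun_le hδ hPi hq hβ hN
  have hcont := continuous_hFun_linePoint hδ hPi hq N hr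
  obtain ⟨M, hM⟩ := (isCompact_Icc (a := -T) (b := T)).exists_bound_of_continuousOn
    hcont.continuousOn
  have hM0 : 0 ≤ M := (norm_nonneg _).trans (hM 0 ⟨by linarith, by linarith⟩)
  have hint : Integrable fun θ : ℝ => (1 + ‖θ‖) ^ (-a) :=
    integrable_one_add_norm (by simpa using ha)
  -- `M * (1 + T) ^ a` covers `|θ| ≤ T`; `K * 2 ^ a` covers the rest, where `1 + |θ| ≤ 2 |θ|`.
  refine (hint.const_mul (M * (1 + T) ^ a + K * 2 ^ a)).mono' hcont.aestronglyMeasurable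
    (ae_of_all _ fun θ => ?_)
  have h1 : 0 < 1 + ‖θ‖ := by positivity
  rw [add_mul, Real.norm_eq_abs θ]
  rw [Real.norm_eq_abs] at h1
  rcases le_total |θ| T with h | h
  · refine le_add_of_le_of_nonneg ((hM θ (abs_le.1 h)).trans ?_) (by positivity)
    have : 1 ≤ (1 + T) ^ a * (1 + |θ|) ^ (-a) := by
      rw [Real.rpow_neg h1.le, ← div_eq_mul_inv, one_le_div (by positivity)]
      gcongr
    rw [mul_assoc]
    exact le_mul_of_one_le_right hM0 this
  · refine le_add_of_nonneg_of_le (by positivity) ?_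
    have h2 := hb (linePoint r θ) (by rwa [linePoint_re]) (by rwa [linePoint_im])
    rw [linePoint_im] at h2
    refine h2.trans ?_
    have h0 : 0 < |θ| := by linarith
    rw [mul_assoc]
    refine mul_le_mul_of_nonneg_left ?_ hK
    have h3 : (2 : ℝ) ^ a = (1 / 2) ^ (-a) := by
      rw [one_div, Real.inv_rpow (by norm_num), Real.rpow_neg (by norm_num), inv_inv]
    rw [h3, ← Real.mul_rpow (by norm_num) h1.le]
    exact Real.rpow_le_rpow_of_nonpos (by positivity) (by linarith) (by linarith)

end

/-! ### Contour shift and Laplace inversion -/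

section

variable {δ : ℝ} {Pi : Measure ℝ} {q : ℝ}

lemma exp_linePoint_mul (r θ x : ℝ) : Complex.exp (linePoint r θ * x) =
    Complex.exp ((r : ℂ) * x) * Complex.exp (Complex.I * θ * x) := by
  rw [← Complex.exp_add, linePoint, add_mul]

lemma norm_exp_linePoint_mul (r θ x : ℝ) :
    ‖Complex.exp (linePoint r θ * x)‖ = Real.exp (r * x) := by
  rw [Complex.norm_exp]
  simp [linePoint]

lemma inversionTerm_eq (N : ℕ) (r x : ℝ) : inversionTerm δ Pi q N r x =
    1 / (2 * (Real.pi : ℂ)) *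
      ∫ θ : ℝ, Complex.exp (linePoint r θ * x) * hFun δ Pi q N (linePoint r θ) := by
  unfold inversionTerm
  simp_rw [exp_linePoint_mul, mul_assoc (Complex.exp ((r : ℂ) * x))]
  rw [integral_const_mul]
  ring

lemma integrable_exp_mul_hFun (hδ : 0 < δ) (hPi : IsLevyMeasure Pi) (hq : 0 ≤ q)
    (hβ : blumenthalGetoor Pi < 1) {N : ℕ} (hN : 1 / (1 - blumenthalGetoor Pi) < (N : ℝ)) {r : ℝ}
    (hr : 0 < r) (x : ℝ) :
    Integrable fun θ : ℝ => Complex.exp (linePoint r θ * x) * hFun δ Pi q N (linePoint r θ) := by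
  refine (integrable_hFun hδ hPi hq hβ hN hr).bdd_mul (c := Real.exp (r * x)) ?_
    (ae_of_all _ fun θ => (norm_exp_linePoint_mul r θ x).le)
  have := continuous_linePoint r
  exact (by fun_prop : Continuous fun θ => Complex.exp (linePoint r θ * x)).aestronglyMeasurable

/-- Shifting the contour: the inversion integral does not depend on the abscissa. -/
lemma inversionTerm_eq_of_le (hδ : 0 < δ) (hPi : IsLevyMeasure Pi) (hq : 0 ≤ q)
    (hβ : blumenthalGetoor Pi < 1) {N : ℕ} (hN : 1 / (1 - blumenthalGetoor Pi) < (N : ℝ))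
    {r r' : ℝ} (hr : 0 < r) (hrr' : r ≤ r') {x : ℝ} (hx : 0 < x) :
    inversionTerm δ Pi q N r x = inversionTerm δ Pi q N r' x := by
  obtain ⟨a, K, T, ha, hK, hT, hb⟩ := exists_norm_hFun_le hδ hPi hq hβ hN
  set G : ℂ → ℂ := fun s => Complex.exp (s * x) * hFun δ Pi q N s with hG
  have hline : ∀ ρ θ : ℝ, (ρ : ℂ) + θ * Complex.I = linePoint ρ θ := fun ρ θ => by
    rw [linePoint, mul_comm]
  have hrect : ∀ t : ℝ, (∫ y in r..r', G (linePoint y (-t))) - (∫ y in r..r', G (linePoint y t)) +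
      Complex.I * (∫ θ in -t..t, G (linePoint r' θ)) -
      Complex.I * (∫ θ in -t..t, G (linePoint r θ)) = 0 := fun t => by
    have h := Complex.integral_boundary_rect_eq_zero_of_differentiableOn G (linePoint r (-t))
      (linePoint r' t) fun s hs => ?_
    · simpa only [linePoint_re, linePoint_im, smul_eq_mul, hline] using h
    · have hs1 : s.re ∈ uIcc r r' := by
        have := hs.1
        rwa [mem_preimage, linePoint_re, linePoint_re] at this
      rw [uIcc_of_le hrr'] at hs1
      refine DifferentiableAt.differentiableWithinAt ?_
      exact (by fun_prop : DifferentiableAt ℂ (fun s : ℂ => Complex.exp (s * x)) s).mul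
        (differentiableAt_hFun hδ hPi hq N (hr.trans_le hs1.1))
  have hdecay : Tendsto (fun t : ℝ => Real.exp (r' * x) * (K * t ^ (-a)) * |r' - r|) atTop
      (𝓝 0) := by
    have := (((tendsto_rpow_neg_atTop (y := a) (by linarith)).const_mul K).const_mul
      (Real.exp (r' * x))).mul_const |r' - r|
    simpa using this
  -- The horizontal sides of the Cauchy rectangle vanish as its height grows, since `h^{N,q}` decays
  -- uniformly on the strip.
  have hhor : ∀ σ : ℝ, |σ| = 1 →
      Tendsto (fun t : ℝ => ∫ y in r..r', G (linePoint y (σ * t))) atTop (𝓝 0) := fun σ hσ => by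
    refine squeeze_zero_norm' ?_ hdecay
    filter_upwards [eventually_ge_atTop T] with t ht
    have ht0 : |σ * t| = t := by rw [abs_mul, hσ, one_mul, abs_of_nonneg (by linarith)]
    refine intervalIntegral.norm_integral_le_of_norm_le_const fun y hy => ?_
    rw [uIoc_of_le hrr'] at hy
    have h1 := hb (linePoint y (σ * t)) (by rw [linePoint_re]; linarith [hy.1])
      (by rw [linePoint_im, ht0]; exact ht)
    rw [linePoint_im, ht0] at h1
    rw [hG, norm_mul, norm_exp_linePoint_mul]
    have := hy.2
    gcongr
  have hver : ∀ ρ, 0 < ρ → Tendsto (fun t : ℝ => ∫ θ in -t..t, G (linePoint ρ θ)) atTop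
      (𝓝 (∫ θ, G (linePoint ρ θ))) := fun ρ hρ =>
    intervalIntegral_tendsto_integral (integrable_exp_mul_hFun hδ hPi hq hβ hN hρ x)
      tendsto_neg_atTop_atBot tendsto_id
  have hlim := (((hhor (-1) (by simp)).sub (hhor 1 (by simp))).add
    ((hver r' (hr.trans_le hrr')).const_mul Complex.I)).sub ((hver r hr).const_mul Complex.I)
  simp only [neg_mul, one_mul, hrect, sub_zero, zero_add] at hlim
  have h0 := tendsto_nhds_unique hlim tendsto_const_nhds
  rw [← mul_sub, mul_eq_zero, or_iff_right Complex.I_ne_zero, sub_eq_zero] at h0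
  rw [inversionTerm_eq, inversionTerm_eq]
  exact congrArg _ h0.symm

open FourierTransform in
/-- Laplace inversion of the remainder of the series on a line far to the right. -/
lemma seriesRemainder_eq_inversionTerm_of_lt (hδ : 0 < δ) (hPi : IsLevyMeasure Pi) (hq : 0 ≤ q)
    (hβ : blumenthalGetoor Pi < 1) {N : ℕ} (hN : 1 / (1 - blumenthalGetoor Pi) < (N : ℝ)) {r : ℝ}
    (hr : 0 < r) (hrδ : realLaplace (tailAdd Pi q) r < δ) {x : ℝ} (hx : 0 < x) :
    (seriesRemainder δ Pi q N x : ℂ) = inversionTerm δ Pi q N r x := by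
  -- Writing `N = k + 2` makes the remainder continuous at `x`, which Fourier inversion at that
  -- point requires.
  obtain ⟨k, rfl⟩ := Nat.exists_eq_add_of_le' (exists_index_of_blumenthalGetoor_lt hPi hβ hN).1
  set F : ℝ → ℂ := fun y =>
    Complex.exp (-((r : ℂ) * y)) * (seriesRemainder δ Pi q (k + 2) y : ℂ) with hF
  have hFi : Integrable F :=
    (laplace_seriesRemainder hδ hPi hq (k + 1) (s := (r : ℂ)) hr hrδ).1
  have hFc : ContinuousAt F x :=
    (by fun_prop : Continuous fun y : ℝ => Complex.exp (-((r : ℂ) * y))).continuousAt.mul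
      (Complex.continuous_ofReal.continuousAt.comp (continuousAt_seriesRemainder hδ hPi hq k hx))
  have hFF : 𝓕 F = fun ξ => hFun δ Pi q (k + 2) (linePoint r (2 * Real.pi * ξ)) := by
    funext ξ
    have hre := linePoint_re r (2 * Real.pi * ξ)
    have h := (laplace_seriesRemainder hδ hPi hq (k + 1) (s := linePoint r (2 * Real.pi * ξ))
      (by rwa [hre]) (by rwa [hre])).2
    rw [← h, Real.fourier_real_eq_integral_exp_smul]
    unfold bilateralLaplace
    refine integral_congr_ae (ae_of_all _ fun y => ?_)
    simp only [hF, smul_eq_mul]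
    rw [← mul_assoc, ← Complex.exp_add]
    congr 2
    rw [linePoint]
    push_cast
    ring
  have h2π : (2 * Real.pi : ℝ) ≠ 0 := by positivity
  have hhi := integrable_hFun hδ hPi hq hβ hN hr
  have hFFi : Integrable (𝓕 F) := by
    rw [hFF]
    exact hhi.comp_mul_left' h2π
  have hinv := hFi.fourierInv_fourier_eq hFFi hFc
  rw [hFF, Real.fourierInv_eq'] at hinv
  set g : ℝ → ℂ := fun θ => Complex.exp (Complex.I * θ * x) * hFun δ Pi q (k + 2) (linePoint r θ)
    with hg
  have hgi : ∫ v : ℝ, Complex.exp (↑(2 * Real.pi * inner ℝ v x) * Complex.I) •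
      hFun δ Pi q (k + 2) (linePoint r (2 * Real.pi * v)) = ∫ v : ℝ, g (2 * Real.pi * v) := by
    refine integral_congr_ae (ae_of_all _ fun v => ?_)
    simp only [hg, smul_eq_mul]
    congr 2
    rw [show inner ℝ v x = x * v from rfl]
    push_cast
    ring
  rw [hgi, Measure.integral_comp_mul_left, abs_of_pos (by positivity)] at hinv
  unfold inversionTerm
  rw [mul_assoc]
  have e : (1 / (2 * (Real.pi : ℂ))) * ∫ θ, g θ = F x := by
    rw [← hinv, Complex.real_smul]
    push_cast
    ring
  rw [e, hF]
  simp only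
  rw [← mul_assoc, ← Complex.exp_add]
  simp

/-- The line is first moved right to `max r r₀`, where the geometric series converges. -/
lemma seriesRemainder_eq_inversionTerm (hδ : 0 < δ) (hPi : IsLevyMeasure Pi) (hq : 0 ≤ q)
    (hβ : blumenthalGetoor Pi < 1) {N : ℕ} (hN : 1 / (1 - blumenthalGetoor Pi) < (N : ℝ)) {r : ℝ}
    (hr : 0 < r) {x : ℝ} (hx : 0 < x) :
    (seriesRemainder δ Pi q N x : ℂ) = inversionTerm δ Pi q N r x := by
  obtain ⟨r₀, hr₀, hrδ₀⟩ := exists_realLaplace_lt hδ hPi hq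
  have hm : 0 < max r r₀ := hr.trans_le (le_max_left _ _)
  have hmδ : realLaplace (tailAdd Pi q) (max r r₀) < δ :=
    (hPi.realLaplace_tailAdd_antitoneOn hq hr₀ hm (le_max_right _ _)).trans_lt hrδ₀
  rw [inversionTerm_eq_of_le hδ hPi hq hβ hN hr (le_max_left r r₀) hx]
  exact seriesRemainder_eq_inversionTerm_of_lt hδ hPi hq hβ hN hm hmδ hx

end

end SubordinatorPotential

/-! ### The theorem -/

open SubordinatorPotential in
theorem mainTheorem5 {Ω : Type*} [MeasurableSpace Ω] (P : Measure Ω) [IsProbabilityMeasure P]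
    (X : ℝ≥0 → Ω → ℝ) (δ : ℝ) (hδ : 0 < δ) (Pi : Measure ℝ)
    (hX : IsSubordinatorWith P X δ Pi) (q : ℝ) (hq : 0 ≤ q) :
    (∃ u : ℝ → ℝ, IsPotentialDensity P X q u) ∧
    (∀ u : ℝ → ℝ, IsPotentialDensity P X q u → ∀ x : ℝ, 0 < x →
      ∃ dRight dLeft : ℝ,
        HasDerivWithinAt u dRight (Ioi x) x ∧
        HasDerivWithinAt u dLeft (Iio x) x ∧
        Summable (fun k : ℕ => seriesTerm δ Pi q x (k + 2)) ∧
        dRight = -(Function.rightLim (tail Pi) x + q) / δ ^ 2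
          + ∑' k : ℕ, seriesTerm δ Pi q x (k + 2) ∧
        dLeft = -(Function.leftLim (tail Pi) x + q) / δ ^ 2
          + ∑' k : ℕ, seriesTerm δ Pi q x (k + 2) ∧
        (blumenthalGetoor Pi < 1 →
          ∀ N : ℕ, 1 / (1 - blumenthalGetoor Pi) < (N : ℝ) → ∀ r : ℝ, 0 < r →
            (dRight : ℂ) = ((-(Function.rightLim (tail Pi) x + q) / δ ^ 2
                + ∑ n ∈ Finset.Ico 2 N, seriesTerm δ Pi q x n : ℝ) : ℂ)
              + inversionTerm δ Pi q N r x ∧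
            (dLeft : ℂ) = ((-(Function.leftLim (tail Pi) x + q) / δ ^ 2
                + ∑ n ∈ Finset.Ico 2 N, seriesTerm δ Pi q x n : ℝ) : ℂ)
              + inversionTerm δ Pi q N r x)) ∧
    (blumenthalGetoor Pi < 1 →
      ∀ N : ℕ, 1 / (1 - blumenthalGetoor Pi) < (N : ℝ) → ∀ r : ℝ, 0 < r →
        (∀ θ : ℝ,
          Integrable (fun x : ℝ =>
            Complex.exp (-(linePoint r θ * x)) * (tailAdd Pi q x : ℂ)) ∧
          1 + 1 / (δ : ℂ) * bilateralLaplace (tailAdd Pi q) (linePoint r θ) ≠ 0) ∧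
        Integrable (fun θ : ℝ => hFun δ Pi q N (linePoint r θ))) := by
  have hPi := hX.isLevyMeasure
  have hd := isPotentialDensity_seriesDensity hδ hX hq
  refine ⟨⟨_, hd⟩, fun u hu x hx => ?_, fun hβ N hN r hr => ⟨fun θ => ?_,
    integrable_hFun hδ hPi hq hβ hN hr⟩⟩
  · have heq : u =ᶠ[𝓝 x] seriesDensity δ Pi q := by
      filter_upwards [Ioi_mem_nhds hx] with y hy
      exact hu.eqOn hd hy
    obtain ⟨hR, hL⟩ := hasDerivWithinAt_seriesDensity hδ hPi hq hx
    refine ⟨_, _, hR.congr_of_eventuallyEq (heq.filter_mono nhdsWithin_le_nhds) heq.eq_of_nhds,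
      hL.congr_of_eventuallyEq (heq.filter_mono nhdsWithin_le_nhds) heq.eq_of_nhds,
      summable_seriesTerm hδ hPi hq 1 x, rfl, rfl, fun hβ N hN r hr => ?_⟩
    have hN2 := (exists_index_of_blumenthalGetoor_lt hPi hβ hN).1
    rw [seriesRemainder_eq_sum_add hδ hPi hq 1 hN2 x,
      ← seriesRemainder_eq_inversionTerm hδ hPi hq hβ hN hr hx]
    constructor <;> push_cast <;> ring
  · have hs : 0 < (linePoint r θ).re := by rwa [linePoint_re]
    exact ⟨(hPi.laplace_tailAdd q hs).1, one_add_bilateralLaplace_ne_zero hδ hPi hq hs⟩
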